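/- Let $n\ge 1$ and let $X=(X_t)_{t\ge 0}$ be an $n$-dimensional Lévy process started at $X_0=0$, i.e. an $\mathbb R^n$-valued process with independent and stationary increments and càdlàg paths. Let $\psi:\mathbb R^n\to\mathbb C$ be its characteristic exponent, i.e. $\mathbb E\, e^{iX_t\cdot\xi}=e^{-t\psi(\xi)}$ for all $t\ge 0$ and $\xi\in\mathbb R^n$. Write $C_\infty(\mathbb R^n)$ for the continuous functions vanishing at infinity, and $p_t$ for a density of the law of $X_t$ with respect to Lebesgue measure (the transition density), whenever it exists. The following conditions are equivalent: (a) (Hartman–Wintner condition) $\displaystyle\lim_{|\xi|\to\infty}\frac{\operatorname{Re}\psi(\xi)}{\ln(1+|\xi|)}=\infty$; (b) for all $t>0$ the transition density exists and has a version $p_t\in C^\infty(\mathbb R^n)$ such that $\nabla^\alpha p_t\in L_1(\mathbb R^n)\cap C_\infty(\mathbb R^n)$ for all multi-indices $\alpha\in\mathbb N_0^n$; (c) for all $t>0$ the transition density exists and $p_t,\nabla p_t\in L_1(\mathbb R^n)$, where $\nabla p_t$ is the weak (distributional) gradient. If, moreover, $X$ is isotropic (that is, $\mathbb P(X_t\in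 B)=\mathbb P(X_t\in LB)$ for all $t\ge 0$, all Borel sets $B\subset\mathbb R^n$ and all isometries $L$ of $\mathbb R^n$ with $L(0)=0$) and $\psi(\xi)=g(|\xi|^2)$ for all $\xi\in\mathbb R^n$ with an increasing (not necessarily strictly) function $g:[0,\infty)\to\mathbb R$, then (a), (b), (c) are also equivalent to each of the following: (d) for all $t>0$ the transition density exists and has a version $p_t\in C_\infty(\mathbb R^n)$; (e) for all $t>0$ the transition density exists and $p_t\in L_\infty(\mathbb R^n)$; (f) $e^{-t\psi}\in L_1(\mathbb R^n)$ for all $t>0$. -/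

import Mathlib

open MeasureTheory ProbabilityTheory Filter Topology
open scoped NNReal ENNReal

/-- `X` is an `n`-dimensional Lévy process under `P`, started at the origin: independent and
stationary increments and, almost surely, right-continuous paths with finite left limits. -/
structure IsLevyProcess {n : ℕ} {Ω : Type*} [MeasurableSpace Ω] (P : Measure Ω)
    (X : ℝ≥0 → Ω → EuclideanSpace ℝ (Fin n)) : Prop where
  measurable : ∀ t, Measurable (X t)
  start : ∀ᵐ ω ∂P, X 0 ω = 0
  indep : HasIndepIncrements X P
  stationary : ∀ s t : ℝ≥0,
    IdentDistrib (fun ω => X (s + t) ω - X s ω) (fun ω => X t ω - X 0 ω) P P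
  cadlag : ∀ᵐ ω ∂P, ∀ t : ℝ≥0,
    ContinuousWithinAt (fun s => X s ω) (Set.Ici t) t ∧
      ∃ l, Tendsto (fun s => X s ω) (𝓝[<] t) (𝓝 l)

/-- `ψ` is the characteristic exponent of `X`: `E exp(i X_t · ξ) = exp(-t ψ(ξ))` for all `t`, `ξ`.
As this is required for all `t`, the function `ψ` is uniquely determined by `X`. -/
def IsCharExponent {n : ℕ} {Ω : Type*} [MeasurableSpace Ω] (P : Measure Ω)
    (X : ℝ≥0 → Ω → EuclideanSpace ℝ (Fin n)) (ψ : EuclideanSpace ℝ (Fin n) → ℂ) : Prop :=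
  ∀ (t : ℝ≥0) (ξ : EuclideanSpace ℝ (Fin n)),
    charFun (P.map (X t)) ξ = Complex.exp (-((t : ℝ) : ℂ) * ψ ξ)

/-- `X` is isotropic: `P(X_t ∈ B) = P(X_t ∈ L B)` for every isometry `L` of `ℝⁿ` fixing the origin
(these are the linear isometries), every Borel set `B` and every `t ≥ 0`. -/
def IsIsotropicProcess {n : ℕ} {Ω : Type*} [MeasurableSpace Ω] (P : Measure Ω)
    (X : ℝ≥0 → Ω → EuclideanSpace ℝ (Fin n)) : Prop :=
  ∀ (L : EuclideanSpace ℝ (Fin n) ≃ₗᵢ[ℝ] EuclideanSpace ℝ (Fin n))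
    (B : Set (EuclideanSpace ℝ (Fin n))), MeasurableSet B →
    ∀ t : ℝ≥0, P (X t ⁻¹' B) = P (X t ⁻¹' (L '' B))

/-- The Hartman–Wintner condition: `Re ψ(ξ) / ln(1 + |ξ|) → ∞` as `|ξ| → ∞`. -/
def HartmanWintner {n : ℕ} (ψ : EuclideanSpace ℝ (Fin n) → ℂ) : Prop :=
  Tendsto (fun ξ => (ψ ξ).re / Real.log (1 + ‖ξ‖))
    (Bornology.cobounded (EuclideanSpace ℝ (Fin n))) atTop

/-- `p` is a (version of the) density of the law of `Y` with respect to Lebesgue measure. -/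
structure IsDensityOf {n : ℕ} {Ω : Type*} [MeasurableSpace Ω] (P : Measure Ω)
    (Y : Ω → EuclideanSpace ℝ (Fin n)) (p : EuclideanSpace ℝ (Fin n) → ℝ) : Prop where
  measurable : Measurable p
  nonneg : ∀ x, 0 ≤ p x
  map_eq : P.map Y = volume.withDensity (fun x => ENNReal.ofReal (p x))

/-- `f ∈ C_∞(ℝⁿ)`: continuous and vanishing at infinity. -/
def IsCInfty {n : ℕ} (f : EuclideanSpace ℝ (Fin n) → ℝ) : Prop :=
  Continuous f ∧ Tendsto f (Bornology.cobounded (EuclideanSpace ℝ (Fin n))) (𝓝 0)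

/-- The partial derivative `∂_{m 0} ⋯ ∂_{m (k-1)} f` of order `k` of a smooth function `f`. Letting
`k` and `m` vary one gets exactly the derivatives `∇^α f`, `α` a multi-index (`k = |α|`). -/
noncomputable def partialDerivative {n k : ℕ} (m : Fin k → Fin n)
    (f : EuclideanSpace ℝ (Fin n) → ℝ) (x : EuclideanSpace ℝ (Fin n)) : ℝ :=
  iteratedFDeriv ℝ k f x (fun j => EuclideanSpace.single (m j) (1 : ℝ))

/-- `v` is the weak (distributional) gradient of `f`. -/
structure IsWeakGradient {n : ℕ} (f : EuclideanSpace ℝ (Fin n) → ℝ)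
    (v : EuclideanSpace ℝ (Fin n) → EuclideanSpace ℝ (Fin n)) : Prop where
  locallyIntegrable : LocallyIntegrable f volume
  locallyIntegrable_grad : LocallyIntegrable v volume
  integral_eq : ∀ φ : EuclideanSpace ℝ (Fin n) → ℝ,
    ContDiff ℝ (⊤ : ℕ∞) φ → HasCompactSupport φ → ∀ i : Fin n,
      ∫ x, f x * fderiv ℝ φ x (EuclideanSpace.single i (1 : ℝ)) = - ∫ x, v x i * φ x

/-- For all `t > 0` there is a density `p_t` of class `C^∞` all of whose derivatives
(including `p_t` itself) are in `L_1 ∩ C_∞`. -/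
def HasSmoothDensities {n : ℕ} {Ω : Type*} [MeasurableSpace Ω] (P : Measure Ω)
    (X : ℝ≥0 → Ω → EuclideanSpace ℝ (Fin n)) : Prop :=
  ∀ t : ℝ≥0, 0 < t → ∃ p : EuclideanSpace ℝ (Fin n) → ℝ,
    IsDensityOf P (X t) p ∧ ContDiff ℝ (⊤ : ℕ∞) p ∧
      ∀ (k : ℕ) (m : Fin k → Fin n),
        Integrable (partialDerivative m p) volume ∧ IsCInfty (partialDerivative m p)

/-- For all `t > 0` there is a density `p_t` such that `p_t` and its weak gradient are in `L_1`. -/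
def HasSobolevDensities {n : ℕ} {Ω : Type*} [MeasurableSpace Ω] (P : Measure Ω)
    (X : ℝ≥0 → Ω → EuclideanSpace ℝ (Fin n)) : Prop :=
  ∀ t : ℝ≥0, 0 < t → ∃ p : EuclideanSpace ℝ (Fin n) → ℝ,
    IsDensityOf P (X t) p ∧ Integrable p volume ∧
      ∃ v : EuclideanSpace ℝ (Fin n) → EuclideanSpace ℝ (Fin n),
        IsWeakGradient p v ∧ Integrable v volume

/-- For all `t > 0` there is a density `p_t` in `C_∞`. -/
def HasCInftyDensities {n : ℕ} {Ω : Type*} [MeasurableSpace Ω] (P : Measure Ω)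
    (X : ℝ≥0 → Ω → EuclideanSpace ℝ (Fin n)) : Prop :=
  ∀ t : ℝ≥0, 0 < t → ∃ p : EuclideanSpace ℝ (Fin n) → ℝ,
    IsDensityOf P (X t) p ∧ IsCInfty p

/-- For all `t > 0` there is a density `p_t` in `L_∞`. -/
def HasBoundedDensities {n : ℕ} {Ω : Type*} [MeasurableSpace Ω] (P : Measure Ω)
    (X : ℝ≥0 → Ω → EuclideanSpace ℝ (Fin n)) : Prop :=
  ∀ t : ℝ≥0, 0 < t → ∃ p : EuclideanSpace ℝ (Fin n) → ℝ,
    IsDensityOf P (X t) p ∧ MemLp p ∞ volume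

/-- `exp(-t ψ) ∈ L_1` for all `t > 0`. -/
def HasIntegrableExp {n : ℕ} (ψ : EuclideanSpace ℝ (Fin n) → ℂ) : Prop :=
  ∀ t : ℝ≥0, 0 < t →
    Integrable (fun ξ => Complex.exp (-((t : ℝ) : ℂ) * ψ ξ)) volume

/-!
The substance is the implication from the Hartman–Wintner condition to smooth densities with
integrable derivatives. The condition says that `exp (-t Re ψ)` decays faster than every power of
`‖ξ‖`, for every `t > 0`. Fourier inversion then gives a bounded smooth density whose derivatives
vanish at infinity. Their integrability is harder, because `ψ` itself need not be differentiable: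
only the jumps of size at most one have a smooth exponent. The Lévy–Khintchine formula, which would
separate these jumps from the others, is replaced by a compound Poisson approximation.

With `n = k + 1`, the function `n² (1 - exp (-ψ / n²))` is the exponent of a compound Poisson law
with jump measure `n²` times the law of the process at time `n⁻²`, and it tends to `ψ`. Cutting
this jump measure at the unit sphere gives a small-jump part `ν₁`, whose second moment is bounded
independently of `n`, and a big-jump part `ν₂` of mass bounded independently of `n`
(`HasExponent.exists_jump_decomposition`; both bounds come from averaging the characteristic
function against a Gaussian, `exists_tail_le`). All derivatives of the exponent of `ν₁` are bounded
by a polynomial (`norm_iteratedFDeriv_charFun_le`). An additional Gaussian factor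
`exp (-t ‖ξ‖² / n)` compensates for the boundedness of the approximating exponents, so that they
satisfy decay estimates uniform in `n` (`HasExponent.exists_approx_decay`). As the Fourier transform
of a rapidly decreasing function with enough controlled derivatives is in `L¹`, the `ν₁` factor is
under control (`exists_lintegral_fourier_mul_cexp_le`). The `ν₂` factor is the characteristic
function of a probability measure: multiplying by it amounts to a convolution, which does not
increase the `L¹` norm (`lintegral_fourier_mul_charFun_le`). Fatou's lemma passes to the limit
(`HasExponent.integrable_fourier_mul_cexp`).

Conversely, an integrable weak gradient tested against `sin ⟪x, ξ⟫` and `cos ⟪x, ξ⟫` gives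
`‖ξ‖ exp (-t Re ψ ξ) ≤ C_t` for every `t > 0`, which is the Hartman–Wintner condition
(`HasSobolevDensities.hartmanWintner`).

If `ψ ξ = g (‖ξ‖²)` with `g` increasing, then `ψ` is real and `exp (-t ψ)` is positive. A bounded
density bounds the Gaussian regularisations of `∫ exp (-t ψ)`, hence `exp (-t ψ)` is integrable
(`HasBoundedDensities.hasIntegrableExp`). By monotonicity, its integral over the ball of radius
`‖ξ‖` is at least the volume of the ball times `exp (-t ψ ξ)`, so that again
`‖ξ‖ exp (-t ψ ξ) ≤ C_t` for `‖ξ‖ ≥ 1` (`HasIntegrableExp.hartmanWintner`).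
-/

/-! ### Fourier transforms and characteristic functions -/

section FourierStieltjes

open scoped FourierTransform RealInnerProductSpace

variable {V : Type*} [NormedAddCommGroup V] [InnerProductSpace ℝ V] [FiniteDimensional ℝ V]
  [MeasurableSpace V] [BorelSpace V]

/-- Fatou's lemma: an `L¹` bound passes to pointwise limits. -/
theorem lintegral_enorm_le_of_tendsto {α E : Type*} [MeasurableSpace α] [NormedAddCommGroup E]
    {μ : Measure α} {F : ℕ → α → E} {f : α → E} {C : ℝ≥0∞}
    (hF : ∀ k, AEStronglyMeasurable (F k) μ) (hC : ∀ k, ∫⁻ x, ‖F k x‖ₑ ∂μ ≤ C)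
    (hlim : ∀ x, Tendsto (fun k => F k x) atTop (𝓝 (f x))) :
    ∫⁻ x, ‖f x‖ₑ ∂μ ≤ C := by
  calc ∫⁻ x, ‖f x‖ₑ ∂μ = ∫⁻ x, liminf (fun k => ‖F k x‖ₑ) atTop ∂μ := by
        congr with x
        exact ((hlim x).enorm.liminf_eq).symm
    _ ≤ liminf (fun k => ∫⁻ x, ‖F k x‖ₑ ∂μ) atTop :=
        lintegral_liminf_le' fun k => (hF k).enorm
    _ ≤ C := liminf_le_of_le (by isBoundedDefault) fun b hb =>
        (hb.exists.choose_spec).trans (hC _)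

theorem continuous_fourier {h : V → ℂ} (hh : Integrable h) : Continuous (𝓕 h) :=
  VectorFourier.fourierIntegral_continuous Real.continuous_fourierChar
      continuous_inner hh

/-- Multiplication by a characteristic function becomes convolution with the measure. The factor
`2 π` translates between the normalisations of `𝓕` and of `charFun`. -/
theorem fourier_mul_charFun (μ : Measure V) [IsFiniteMeasure μ] {h : V → ℂ} (hh : Integrable h)
    (x : V) :
    𝓕 (fun ξ => h ξ * charFun μ ((2 * Real.pi) • ξ)) x = ∫ y, 𝓕 h (x - y) ∂μ := by
  simp only [Real.fourier_eq', charFun_apply, smul_eq_mul]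
  have key : ∀ ξ : V, Complex.exp ((↑(-2 * Real.pi * ⟪ξ, x⟫) : ℂ) * Complex.I) *
      (h ξ * ∫ y, Complex.exp ((⟪y, (2 * Real.pi) • ξ⟫ : ℝ) * Complex.I) ∂μ) =
      ∫ y, Complex.exp ((↑(-2 * Real.pi * ⟪ξ, x - y⟫) : ℂ) * Complex.I) * h ξ ∂μ := by
    intro ξ
    rw [← integral_const_mul, ← integral_const_mul]
    congr with y
    rw [mul_comm (h ξ), ← mul_assoc, ← Complex.exp_add]
    congr 2
    rw [inner_sub_right, inner_smul_right, real_inner_comm y ξ]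
    push_cast
    ring
  simp_rw [key]
  rw [integral_integral_swap]
  have h2 : Integrable (fun z : V × V => h z.1) (volume.prod μ) := hh.comp_fst μ
  refine h2.bdd_mul (c := 1) (by fun_prop) (ae_of_all _ fun z => ?_)
  exact (Complex.norm_exp_ofReal_mul_I _).le

/-- Convolution with a finite measure `μ` increases the `L¹` norm by at most the factor
`μ univ`. This disposes of the big jumps, whose characteristic function is not smooth. -/
theorem lintegral_fourier_mul_charFun_le (μ : Measure V) [IsFiniteMeasure μ] {h : V → ℂ}
    (hh : Integrable h) :
    ∫⁻ x, ‖𝓕 (fun ξ => h ξ * charFun μ ((2 * Real.pi) • ξ)) x‖ₑ ≤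
      (∫⁻ x, ‖𝓕 h x‖ₑ) * μ Set.univ := by
  have hc := continuous_fourier hh
  calc _ ≤ ∫⁻ x, ∫⁻ y, ‖𝓕 h (x - y)‖ₑ ∂μ := by
        refine lintegral_mono fun x => ?_
        rw [fourier_mul_charFun μ hh]
        exact enorm_integral_le_lintegral_enorm _
    _ = ∫⁻ y, (∫⁻ x, ‖𝓕 h (x - y)‖ₑ) ∂μ := by
        refine lintegral_lintegral_swap (μ := volume) (ν := μ) (f := fun x y => ‖𝓕 h (x - y)‖ₑ) ?_
        exact (hc.comp (continuous_fst.sub continuous_snd)).measurable.enorm.aemeasurable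
    _ = _ := by
        rw [← lintegral_const]
        exact lintegral_congr fun y => lintegral_sub_right_eq_self (fun x => ‖𝓕 h x‖ₑ) y

theorem integrable_cexp_neg_mul_norm_sq {b : ℝ} (hb : 0 < b) :
    Integrable (fun ξ : V => Complex.exp (-(b : ℂ) * ‖ξ‖ ^ 2)) := by
  simpa using GaussianFourier.integrable_cexp_neg_mul_sq_norm_add (V := V) (b := (b : ℂ))
    (by simpa using hb) 0 0

/-- The Gaussian probability density which is the Fourier transform of `exp (- b ‖ξ‖ ^ 2)`, as a
real function. It concentrates at the origin as `b` tends to `0`. -/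
noncomputable def heatKernel (V : Type*) [NormedAddCommGroup V] [InnerProductSpace ℝ V]
    (b : ℝ) (x : V) : ℝ :=
  (Real.pi / b) ^ (Module.finrank ℝ V / 2 : ℝ) * Real.exp (-(Real.pi ^ 2 / b) * ‖x‖ ^ 2)

omit [FiniteDimensional ℝ V] [MeasurableSpace V] [BorelSpace V] in
theorem heatKernel_nonneg {b : ℝ} (hb : 0 < b) (x : V) : 0 ≤ heatKernel V b x := by
  unfold heatKernel
  positivity

theorem fourier_gaussian_eq_heatKernel {b : ℝ} (hb : 0 < b) (x : V) :
    𝓕 (fun ξ : V => Complex.exp (-(b : ℂ) * ‖ξ‖ ^ 2)) x = heatKernel V b x := by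
  rw [fourier_gaussian_innerProductSpace (by simpa using hb), heatKernel]
  push_cast
  rw [Complex.ofReal_cpow (by positivity)]
  push_cast
  congr 2
  ring

theorem lintegral_heatKernel {b : ℝ} (hb : 0 < b) :
    ∫⁻ x : V, ENNReal.ofReal (heatKernel V b x) = 1 := by
  have hp := Real.pi_pos
  have hpb : 0 < Real.pi ^ 2 / b := by positivity
  have hint : Integrable (fun x : V => Real.exp (-(Real.pi ^ 2 / b) * ‖x‖ ^ 2)) := by
    have := (integrable_cexp_neg_mul_norm_sq (V := V) hpb).norm
    refine this.congr (ae_of_all _ fun x => ?_)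
    simp only [Complex.norm_exp]
    congr 1
    norm_cast
  rw [← ofReal_integral_eq_lintegral_ofReal (f := heatKernel V b) (hint.const_mul _)
    (ae_of_all _ fun x => heatKernel_nonneg hb x)]
  unfold heatKernel
  rw [integral_const_mul, GaussianFourier.integral_rexp_neg_mul_sq_norm hpb,
    ← Real.mul_rpow (by positivity) (by positivity)]
  have : Real.pi / b * (Real.pi / (Real.pi ^ 2 / b)) = 1 := by field_simp
  rw [this, Real.one_rpow, ENNReal.ofReal_one]

theorem tendsto_fourier_gaussian_mul {f : V → ℂ} (hf : Integrable f) (x : V) :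
    Tendsto (fun k : ℕ => 𝓕 (fun ξ => Complex.exp (-((k + 1 : ℝ)⁻¹ : ℝ) * ‖ξ‖ ^ 2) * f ξ) x) atTop
      (𝓝 (𝓕 f x)) := by
  have h := Real.tendsto_integral_cexp_sq_smul (V := V)
    ((Real.fourierIntegral_convergent_iff x).2 hf)
  have h2 : Tendsto (fun k : ℕ => (k + 1 : ℝ)) atTop atTop :=
    tendsto_atTop_add_const_right _ _ tendsto_natCast_atTop_atTop
  refine (h.comp h2).congr fun k => ?_
  rw [Real.fourier_eq]
  refine integral_congr_ae (ae_of_all _ fun ξ => ?_)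
  simp [Circle.smul_def]
  ring

theorem fourier_gaussian_mul_charFun (μ : Measure V) [IsFiniteMeasure μ] {b : ℝ} (hb : 0 < b)
    (x : V) :
    𝓕 (fun ξ => Complex.exp (-(b : ℂ) * ‖ξ‖ ^ 2) * charFun μ ((2 * Real.pi) • ξ)) x =
      ((∫ y, heatKernel V b (x - y) ∂μ : ℝ) : ℂ) := by
  rw [fourier_mul_charFun μ (integrable_cexp_neg_mul_norm_sq hb), ← integral_complex_ofReal]
  simp_rw [fourier_gaussian_eq_heatKernel hb]

/-- An integrable characteristic function has a nonnegative real Fourier transform, as a limit of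
the nonnegative Gaussian regularisations. -/
theorem fourier_charFun_nonneg (μ : Measure V) [IsFiniteMeasure μ]
    (hμ : Integrable (fun ξ => charFun μ ((2 * Real.pi) • ξ))) (x : V) :
    0 ≤ (𝓕 (fun ξ => charFun μ ((2 * Real.pi) • ξ)) x).re ∧
      (𝓕 (fun ξ => charFun μ ((2 * Real.pi) • ξ)) x).im = 0 := by
  have h := tendsto_fourier_gaussian_mul hμ x
  have hk : ∀ k : ℕ, (0 : ℝ) < (k + 1 : ℝ)⁻¹ := fun k => by positivity
  simp_rw [fun k => fourier_gaussian_mul_charFun μ (hk k) x] at h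
  have hre := (Complex.continuous_re.tendsto _).comp h
  have him := (Complex.continuous_im.tendsto _).comp h
  refine ⟨ge_of_tendsto' hre fun k => ?_, tendsto_nhds_unique him ?_⟩
  · exact integral_nonneg fun y => heatKernel_nonneg (hk k) _
  · simp [Function.comp_def]

theorem integrable_fourier_charFun (μ : Measure V) [IsFiniteMeasure μ]
    (hμ : Integrable (fun ξ => charFun μ ((2 * Real.pi) • ξ))) :
    Integrable (𝓕 (fun ξ => charFun μ ((2 * Real.pi) • ξ))) := by
  have hk : ∀ k : ℕ, (0 : ℝ) < (k + 1 : ℝ)⁻¹ := fun k => by positivity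
  refine ⟨(continuous_fourier hμ).aestronglyMeasurable, ?_⟩
  refine lt_of_le_of_lt (lintegral_enorm_le_of_tendsto (C := μ Set.univ) (fun k => ?_) (fun k => ?_)
    (tendsto_fourier_gaussian_mul hμ)) (measure_lt_top _ _)
  · refine (continuous_fourier ?_).aestronglyMeasurable
    refine (integrable_cexp_neg_mul_norm_sq (hk k)).mul_bdd (c := μ.real Set.univ) (by fun_prop) ?_
    exact ae_of_all _ fun ξ => norm_charFun_le _
  · refine (lintegral_fourier_mul_charFun_le μ (integrable_cexp_neg_mul_norm_sq (hk k))).trans ?_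
    simp_rw [fourier_gaussian_eq_heatKernel (hk k)]
    have : ∀ x : V, ‖(heatKernel V (k + 1 : ℝ)⁻¹ x : ℂ)‖ₑ
        = ENNReal.ofReal (heatKernel V (k + 1 : ℝ)⁻¹ x) := fun x => by
      rw [← ofReal_norm, Complex.norm_real, Real.norm_of_nonneg (heatKernel_nonneg (hk k) x)]
    simp_rw [this, lintegral_heatKernel (hk k), one_mul]
    exact le_rfl

/-- A finite measure with integrable characteristic function `φ` has the density `𝓕 φ` (up to the
scaling by `2 π`). The right-hand side has the same characteristic function as `μ`, by Fourier
inversion. -/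
theorem eq_withDensity_fourier_charFun (μ : Measure V) [IsFiniteMeasure μ]
    (hμ : Integrable (fun ξ => charFun μ ((2 * Real.pi) • ξ))) :
    μ = volume.withDensity fun x =>
      ENNReal.ofReal (𝓕 (fun ξ => charFun μ ((2 * Real.pi) • ξ)) x).re := by
  set φ : V → ℂ := fun ξ => charFun μ ((2 * Real.pi) • ξ) with hφ
  have hφc : Continuous φ := by fun_prop
  have hint := integrable_fourier_charFun μ hμ
  have hre : ∀ x, (((𝓕 φ x).re : ℝ) : ℂ) = 𝓕 φ x := fun x =>
    Complex.ext rfl (fourier_charFun_nonneg μ hμ x).2.symm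
  have hm : Measurable fun x => (𝓕 φ x).re :=
    (Complex.continuous_re.comp (continuous_fourier hμ)).measurable
  have : IsFiniteMeasure (volume.withDensity fun x => ENNReal.ofReal (𝓕 φ x).re) :=
    isFiniteMeasure_withDensity_ofReal hint.re.2
  refine Measure.ext_of_charFun ?_
  ext t
  have hinv := congrFun (hφc.fourierInv_fourier_eq hμ hint) ((2 * Real.pi)⁻¹ • t)
  rw [hφ] at hinv
  simp only [smul_smul, mul_inv_cancel₀ Real.two_pi_pos.ne', one_smul] at hinv
  rw [← hinv, ← hφ, charFun_apply, integral_withDensity_eq_integral_toReal_smul hm.ennreal_ofReal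
    (ae_of_all _ fun x => ENNReal.ofReal_lt_top), Real.fourierInv_eq']
  refine integral_congr_ae (ae_of_all _ fun x => ?_)
  have hx : 2 * Real.pi * ⟪x, (2 * Real.pi)⁻¹ • t⟫ = ⟪x, t⟫ := by
    rw [inner_smul_right]
    field_simp
  simp only [hx]
  rw [ENNReal.toReal_ofReal (fourier_charFun_nonneg μ hμ x).1, Complex.real_smul, hre, smul_eq_mul,
    mul_comm]

end FourierStieltjes

/-! ### Compound Poisson laws -/

section CompoundPoisson

open scoped RealInnerProductSpace

variable {V : Type*} [NormedAddCommGroup V] [InnerProductSpace ℝ V] [FiniteDimensional ℝ V]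
  [MeasurableSpace V] [BorelSpace V]

/-- The `k`-fold convolution power of a measure. -/
noncomputable def convPow (ν : Measure V) : ℕ → Measure V
  | 0 => Measure.dirac 0
  | k + 1 => (convPow ν k).conv ν

instance isFiniteMeasure_convPow (ν : Measure V) [IsFiniteMeasure ν] :
    ∀ k, IsFiniteMeasure (convPow ν k)
  | 0 => by unfold convPow; infer_instance
  | k + 1 => by
    have := isFiniteMeasure_convPow ν k
    unfold convPow
    infer_instance

theorem charFun_convPow (ν : Measure V) [IsFiniteMeasure ν] (k : ℕ) (ξ : V) :
    charFun (convPow ν k) ξ = charFun ν ξ ^ k := by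
  induction k with
  | zero => simp [convPow, charFun_dirac]
  | succ k ih => rw [convPow, charFun_conv, ih, pow_succ]

theorem measureReal_convPow_univ (ν : Measure V) [IsFiniteMeasure ν] (k : ℕ) :
    (convPow ν k).real Set.univ = ν.real Set.univ ^ k := by
  have := charFun_convPow ν k 0
  simp only [charFun_zero] at this
  exact_mod_cast this

/-- The compound Poisson law with jump measure `ν`, a finite measure that need not be normalised:
the mixture `∑ e^{-|ν|} ν^{*k} / k!` of the convolution powers of `ν`. -/
noncomputable def compoundPoisson (ν : Measure V) : Measure V :=
  Measure.sum fun k : ℕ =>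
    ENNReal.ofReal (Real.exp (-ν.real Set.univ) * (k.factorial : ℝ)⁻¹) • convPow ν k

instance isProbabilityMeasure_compoundPoisson (ν : Measure V) [IsFiniteMeasure ν] :
    IsProbabilityMeasure (compoundPoisson ν) := by
  constructor
  rw [compoundPoisson, Measure.sum_apply _ MeasurableSet.univ]
  have h : ∀ k : ℕ, (ENNReal.ofReal (Real.exp (-ν.real Set.univ) * (k.factorial : ℝ)⁻¹) •
      convPow ν k) Set.univ =
      ENNReal.ofReal (Real.exp (-ν.real Set.univ) * (ν.real Set.univ ^ k / k.factorial)) := by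
    intro k
    rw [Measure.smul_apply, smul_eq_mul, ← ofReal_measureReal, measureReal_convPow_univ,
      ← ENNReal.ofReal_mul (by positivity)]
    congr 1
    ring
  have hs := (Real.summable_pow_div_factorial (ν.real Set.univ)).mul_left
    (Real.exp (-ν.real Set.univ))
  simp_rw [h]
  rw [← ENNReal.ofReal_tsum_of_nonneg (fun k => by positivity) hs, tsum_mul_left]
  have : ∑' k : ℕ, ν.real Set.univ ^ k / (k.factorial : ℝ) = Real.exp (ν.real Set.univ) := by
    rw [Real.exp_eq_exp_ℝ, NormedSpace.exp_eq_tsum_div]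
  rw [this, ← Real.exp_add]
  simp

theorem charFun_compoundPoisson (ν : Measure V) [IsFiniteMeasure ν] (ξ : V) :
    charFun (compoundPoisson ν) ξ = Complex.exp (charFun ν ξ - ν.real Set.univ) := by
  have hint : Integrable (fun x : V => Complex.exp ((⟪x, ξ⟫ : ℝ) * Complex.I))
      (compoundPoisson ν) :=
    Integrable.of_bound (by fun_prop) 1 (ae_of_all _ fun x => (Complex.norm_exp_ofReal_mul_I _).le)
  have h1 := hasSum_integral_measure hint
  have h2 : HasSum (fun k : ℕ => Complex.exp (-ν.real Set.univ) *
      (charFun ν ξ ^ k / k.factorial)) (Complex.exp (charFun ν ξ - ν.real Set.univ)) := by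
    have := (NormedSpace.expSeries_div_hasSum_exp (charFun ν ξ)).mul_left
      (Complex.exp (-ν.real Set.univ))
    rwa [← Complex.exp_eq_exp_ℂ, ← Complex.exp_add, neg_add_eq_sub] at this
  refine h1.unique (h2.congr_fun fun k => ?_)
  rw [integral_smul_measure, ← charFun_apply, charFun_convPow,
    ENNReal.toReal_ofReal (by positivity), Complex.real_smul]
  push_cast
  ring

end CompoundPoisson

/-! ### Integrability of Fourier transforms from derivative bounds -/

section Bounds

open scoped FourierTransform RealInnerProductSpace ContDiff

variable {V : Type*} [NormedAddCommGroup V] [InnerProductSpace ℝ V]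

/-- Derivatives of `exp ∘ G` are bounded by a power of a bound for the derivatives of `G`, times
`‖exp ∘ G‖`. No bound for `G` itself enters, and the constant does not depend on `G`. -/
theorem exists_norm_iteratedFDeriv_cexp_le (V : Type*) [NormedAddCommGroup V]
    [InnerProductSpace ℝ V] (n : ℕ) :
    ∃ K : ℝ, 0 ≤ K ∧ ∀ G : V → ℂ, ContDiff ℝ ∞ G → ∀ (x : V) (A : ℝ), 1 ≤ A →
      (∀ j, 1 ≤ j → j ≤ n → ‖iteratedFDeriv ℝ j G x‖ ≤ A) →
      ‖iteratedFDeriv ℝ n (fun y => Complex.exp (G y)) x‖ ≤ K * A ^ n * ‖Complex.exp (G x)‖ := by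
  induction n using Nat.strong_induction_on with
  | _ n ih =>
  rcases n with _ | n
  · exact ⟨1, zero_le_one, fun G _ x A _ _ => by simp⟩
  choose! K hK0 hK using ih
  refine ⟨∑ i ∈ Finset.range (n + 1), n.choose i * K i, Finset.sum_nonneg fun i hi => ?_, ?_⟩
  · have := hK0 i (by simpa using hi)
    positivity
  intro G hG x A hA hj
  have hf : fderiv ℝ (fun y => Complex.exp (G y)) = fun y => Complex.exp (G y) • fderiv ℝ G y := by
    ext1 y
    exact ((hG.differentiable (by simp) y).hasFDerivAt.cexp).fderiv
  rw [← norm_iteratedFDeriv_fderiv, hf]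
  refine (norm_iteratedFDeriv_smul_le (N := ∞) (by fun_prop)
    (hG.fderiv_right (m := ∞) (by simp)) x (by exact_mod_cast le_top)).trans ?_
  rw [Finset.sum_mul, Finset.sum_mul]
  refine Finset.sum_le_sum fun i hi => ?_
  have hi' : i < n + 1 := by simpa using hi
  have h1 := hK i hi' G hG x A hA fun j hj1 hj2 => hj j hj1 (by omega)
  have h2 : ‖iteratedFDeriv ℝ (n - i) (fderiv ℝ G) x‖ ≤ A := by
    rw [norm_iteratedFDeriv_fderiv]
    exact hj _ (by omega) (by omega)
  have hK0' := hK0 i hi'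
  calc _ ≤ n.choose i * (K i * A ^ i * ‖Complex.exp (G x)‖) * A := by gcongr
    _ = n.choose i * K i * A ^ (i + 1) * ‖Complex.exp (G x)‖ := by ring
    _ ≤ _ := by
      gcongr
      omega

/-- Rapid decay of `exp ∘ G` absorbs the polynomial growth of `q` and of the derivatives of `G`. The
bound `B` is uniform in `G`. -/
theorem exists_norm_iteratedFDeriv_mul_cexp_le {q : V → ℂ} (hq : q.HasTemperateGrowth)
    (N k : ℕ) (C : ℝ) (D : ℕ → ℝ) :
    ∃ B : ℝ, ∀ G : V → ℂ, ContDiff ℝ ∞ G →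
      (∀ j, 1 ≤ j → j ≤ N → ∀ ξ, ‖iteratedFDeriv ℝ j G ξ‖ ≤ C * (1 + ‖ξ‖) ^ k) →
      (∀ M ξ, ‖Complex.exp (G ξ)‖ * (1 + ‖ξ‖) ^ M ≤ D M) →
      ∀ n ≤ N, ∀ ξ, ‖iteratedFDeriv ℝ n (fun y => q y * Complex.exp (G y)) ξ‖ * (1 + ‖ξ‖) ^ N
        ≤ B := by
  obtain ⟨kq, Cq, hCq, hqb⟩ := hq.norm_iteratedFDeriv_le_uniform N
  choose K hK0 hK using exists_norm_iteratedFDeriv_cexp_le V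
  set C1 := max C 1
  have hC1 : 1 ≤ C1 := le_max_right _ _
  refine ⟨∑ n ∈ Finset.range (N + 1), ∑ i ∈ Finset.range (n + 1),
    n.choose i * Cq * (K (n - i) * C1 ^ N) * D (kq + k * N + N), ?_⟩
  intro G hG hGb hGD n hn ξ
  have hD0 : ∀ M, 0 ≤ D M := fun M => le_trans (by positivity) (hGD M ξ)
  have hx : 1 ≤ 1 + ‖ξ‖ := by simp
  refine le_trans ?_ (Finset.single_le_sum (f := fun n => ∑ i ∈ Finset.range (n + 1),
    n.choose i * Cq * (K (n - i) * C1 ^ N) * D (kq + k * N + N)) (fun n _ => ?_)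
    (Finset.mem_range.2 (Nat.lt_succ_of_le hn)))
  swap
  · refine Finset.sum_nonneg fun i _ => ?_
    have := hK0 (n - i)
    have := hD0 (kq + k * N + N)
    positivity
  refine (mul_le_mul_of_nonneg_right (norm_iteratedFDeriv_mul_le (N := ∞) hq.1 (by fun_prop) ξ
    (by exact_mod_cast le_top)) (by positivity)).trans ?_
  rw [Finset.sum_mul]
  refine Finset.sum_le_sum fun i hi => ?_
  have hi' : i ≤ n := by simpa [Nat.lt_succ_iff] using hi
  have hA : 1 ≤ C1 * (1 + ‖ξ‖) ^ k := one_le_mul_of_one_le_of_one_le hC1 (one_le_pow₀ hx)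
  have h1 := hK (n - i) G hG ξ (C1 * (1 + ‖ξ‖) ^ k) hA fun j hj1 hj2 =>
    (hGb j hj1 (by omega) ξ).trans (by gcongr; exact le_max_left _ _)
  have h1' : ‖iteratedFDeriv ℝ (n - i) (fun y => Complex.exp (G y)) ξ‖ ≤
      K (n - i) * (C1 * (1 + ‖ξ‖) ^ k) ^ N * ‖Complex.exp (G ξ)‖ := by
    refine h1.trans ?_
    have := hK0 (n - i)
    gcongr
    omega
  have h2 := hqb i (by omega) ξ
  have := hK0 (n - i)
  calc _ ≤ n.choose i * (Cq * (1 + ‖ξ‖) ^ kq) *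
        (K (n - i) * (C1 * (1 + ‖ξ‖) ^ k) ^ N * ‖Complex.exp (G ξ)‖) * (1 + ‖ξ‖) ^ N := by gcongr
    _ = n.choose i * Cq * (K (n - i) * C1 ^ N) *
        (‖Complex.exp (G ξ)‖ * (1 + ‖ξ‖) ^ (kq + k * N + N)) := by ring
    _ ≤ _ := by
      gcongr
      exact hGD _ _

variable [FiniteDimensional ℝ V] [MeasurableSpace V] [BorelSpace V]

theorem integrable_inv_one_add_norm_pow (V : Type*) [NormedAddCommGroup V] [InnerProductSpace ℝ V]
    [FiniteDimensional ℝ V] [MeasurableSpace V] [BorelSpace V] :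
    Integrable (fun ξ : V => ((1 + ‖ξ‖) ^ (Module.finrank ℝ V + 1))⁻¹) := by
  have := integrable_one_add_norm (E := V) (μ := volume) (r := (Module.finrank ℝ V + 1 : ℕ))
    (by push_cast; linarith)
  refine this.congr (ae_of_all _ fun ξ => ?_)
  simp only
  rw [Real.rpow_neg (by positivity), Real.rpow_natCast]

/-- An `L¹` bound for the Fourier transform of `q * exp ∘ G`, uniform in `G`. It needs derivatives
of `G` up to order `finrank ℝ V + 1` only: they give decay of the Fourier transform of that order. -/
theorem exists_lintegral_fourier_mul_cexp_le {q : V → ℂ} (hq : q.HasTemperateGrowth)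
    (k : ℕ) (C : ℝ) (D : ℕ → ℝ) :
    ∃ B : ℝ≥0, ∀ G : V → ℂ, ContDiff ℝ ∞ G →
      (∀ j, 1 ≤ j → j ≤ Module.finrank ℝ V + 1 → ∀ ξ,
        ‖iteratedFDeriv ℝ j G ξ‖ ≤ C * (1 + ‖ξ‖) ^ k) →
      (∀ M ξ, ‖Complex.exp (G ξ)‖ * (1 + ‖ξ‖) ^ M ≤ D M) →
      Integrable (fun ξ => q ξ * Complex.exp (G ξ)) ∧
      ∫⁻ x, ‖𝓕 (fun ξ => q ξ * Complex.exp (G ξ)) x‖ₑ ≤ B := by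
  set N := Module.finrank ℝ V + 1
  obtain ⟨B, hB⟩ := exists_norm_iteratedFDeriv_mul_cexp_le hq N k C D
  have hJ : Integrable (fun ξ : V => ((1 + ‖ξ‖) ^ N)⁻¹) := integrable_inv_one_add_norm_pow V
  set J := ∫ ξ : V, ((1 + ‖ξ‖) ^ N)⁻¹
  set S : ℝ := (2 : ℝ) ^ N * ((N + 1) * (B * J)) with hS
  refine ⟨(2 ^ (N - 1) * (S + S) * J).toNNReal, fun G hG hGb hGD => ?_⟩
  set h : V → ℂ := fun ξ => q ξ * Complex.exp (G ξ)
  have hhs : ContDiff ℝ ∞ h := hq.1.mul (by fun_prop)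
  have hb : ∀ n ≤ N, ∀ ξ, ‖iteratedFDeriv ℝ n h ξ‖ ≤ B * ((1 + ‖ξ‖) ^ N)⁻¹ := fun n hn ξ => by
    rw [← div_eq_mul_inv, le_div_iff₀ (by positivity)]
    exact hB G hG hGb hGD n hn ξ
  have hint : ∀ n ≤ N, Integrable (iteratedFDeriv ℝ n h) := fun n hn =>
    (hJ.const_mul B).mono'
      (hhs.continuous_iteratedFDeriv (by exact_mod_cast le_top)).aestronglyMeasurable
      (ae_of_all _ (hb n hn))
  have hint' : ∀ n ≤ N, ∫ ξ, ‖iteratedFDeriv ℝ n h ξ‖ ≤ B * J := fun n hn => by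
    rw [← integral_const_mul]
    exact integral_mono (hint n hn).norm (hJ.const_mul B) (hb n hn)
  have hBJ : 0 ≤ B * J :=
    le_trans (integral_nonneg fun _ => norm_nonneg _) (hint' 0 (Nat.zero_le _))
  have hw : ∀ n ≤ N, ∀ w, ‖w‖ ^ n * ‖𝓕 h w‖ ≤ S := fun n hn w => by
    have := Real.pow_mul_norm_iteratedFDeriv_fourier_le (K := 0) (N := N)
      (hhs.of_le (by exact_mod_cast le_top)) (fun k n hk hn => ?_) (k := 0) le_rfl
      (n := n) (by exact_mod_cast hn) w
    · simp only [norm_iteratedFDeriv_zero, pow_zero, one_mul, Nat.cast_zero, mul_zero,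
        zero_add] at this
      refine this.trans ?_
      rw [hS]
      gcongr
      · norm_num
      · rw [Finset.sum_product]
        simp only [Finset.range_one, Finset.sum_singleton, pow_zero, one_mul]
        refine (Finset.sum_le_card_nsmul _ _ (B * J) fun p hp => hint' p ?_).trans ?_
        · have := Finset.mem_range.1 hp
          omega
        · rw [Finset.card_range, nsmul_eq_mul]
          push_cast
          gcongr
    · have hk0 : k = 0 := by simpa using hk
      subst hk0
      simpa using (hint n (by exact_mod_cast hn)).norm
  -- Combining the bounds for `‖𝓕 h w‖` and for `‖w‖ ^ N * ‖𝓕 h w‖` gives an integrable majorant.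
  have hfin : ∀ w, ‖𝓕 h w‖ ≤ 2 ^ (N - 1) * (S + S) * ((1 + ‖w‖) ^ N)⁻¹ := fun w => by
    rw [← div_eq_mul_inv, le_div_iff₀ (by positivity)]
    have h0 := hw 0 (Nat.zero_le _) w
    have h1 := hw N le_rfl w
    calc _ ≤ ‖𝓕 h w‖ * (2 ^ (N - 1) * (1 ^ N + ‖w‖ ^ N)) := by
          gcongr
          exact add_pow_le zero_le_one (norm_nonneg _) N
      _ = 2 ^ (N - 1) * (‖w‖ ^ 0 * ‖𝓕 h w‖ + ‖w‖ ^ N * ‖𝓕 h w‖) := by ring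
      _ ≤ _ := by gcongr
  have h0 : Integrable h := by
    refine (hJ.const_mul B).mono' hhs.continuous.aestronglyMeasurable (ae_of_all _ fun ξ => ?_)
    simpa using hb 0 (Nat.zero_le _) ξ
  refine ⟨h0, ?_⟩
  calc _ ≤ ∫⁻ w : V, ENNReal.ofReal (2 ^ (N - 1) * (S + S) * ((1 + ‖w‖) ^ N)⁻¹) := by
        refine lintegral_mono fun w => ?_
        rw [← ofReal_norm]
        exact ENNReal.ofReal_le_ofReal (hfin w)
    _ = ENNReal.ofReal (2 ^ (N - 1) * (S + S) * J) := by
        rw [← ofReal_integral_eq_lintegral_ofReal (hJ.const_mul _)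
          (ae_of_all _ fun w => by positivity), integral_const_mul]
    _ ≤ _ := le_rfl

end Bounds

/-! ### Characteristic exponents and tails of the laws -/

section Exponent

open scoped RealInnerProductSpace

/-- `exp (-z)` is 1-Lipschitz on the right half-plane. -/
theorem norm_one_sub_cexp_neg_le {z : ℂ} (hz : 0 ≤ z.re) : ‖1 - Complex.exp (-z)‖ ≤ ‖z‖ := by
  have hconv : Convex ℝ {w : ℂ | 0 ≤ w.re} := convex_halfSpace_re_ge 0
  have hd : ∀ w ∈ {w : ℂ | 0 ≤ w.re},
      HasDerivWithinAt (fun w : ℂ => Complex.exp (-w)) (-Complex.exp (-w)) {w : ℂ | 0 ≤ w.re} w :=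
      fun w _ => by simpa using ((hasDerivAt_neg w).cexp).hasDerivWithinAt
  have := hconv.norm_image_sub_le_of_norm_hasDerivWithin_le (C := 1) hd (fun w hw => ?_)
    (x := z) (y := 0) hz (by simp)
  · simpa using this
  · rw [norm_neg, Complex.norm_exp]
    simpa using hw

theorem one_sub_cos_nat_mul_le (k : ℕ) (x : ℝ) :
    1 - Real.cos (k * x) ≤ k ^ 2 * (1 - Real.cos x) := by
  have hsin : ∀ (k : ℕ) (y : ℝ), |Real.sin (k * y)| ≤ k * |Real.sin y| := by
    intro k y
    induction k with
    | zero => simp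
    | succ k ih =>
      push_cast
      rw [add_mul, one_mul, Real.sin_add, add_mul, one_mul]
      refine (abs_add_le _ _).trans (add_le_add ?_ ?_)
      · rw [abs_mul]
        exact (mul_le_of_le_one_right (abs_nonneg _) (Real.abs_cos_le_one _)).trans ih
      · rw [abs_mul]
        exact mul_le_of_le_one_left (abs_nonneg _) (Real.abs_cos_le_one _)
  have h2 : ∀ y : ℝ, 1 - Real.cos (2 * y) = 2 * |Real.sin y| ^ 2 := fun y => by
    rw [Real.cos_two_mul, sq_abs, Real.sin_sq]
    ring
  have e1 : (k : ℝ) * x = 2 * (k * (x / 2)) := by ring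
  have e2 : x = 2 * (x / 2) := by ring
  rw [e1, h2]
  conv_rhs => rw [e2, h2]
  have := pow_le_pow_left₀ (abs_nonneg _) (hsin k (x / 2)) 2
  rw [mul_pow] at this
  linarith

theorem div_one_add_le_one_sub_exp_neg {y : ℝ} (hy : 0 ≤ y) : y / (1 + y) ≤ 1 - Real.exp (-y) := by
  have h1 : Real.exp (-y) ≤ (1 + y)⁻¹ := by
    rw [Real.exp_neg]
    exact inv_anti₀ (by positivity) (by linarith [Real.add_one_le_exp y])
  have h2 : y / (1 + y) = 1 - (1 + y)⁻¹ := by field_simp; ring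
  linarith

variable {V : Type*} [NormedAddCommGroup V] [InnerProductSpace ℝ V] [FiniteDimensional ℝ V]
  [MeasurableSpace V] [BorelSpace V]

theorem integrable_cexp_inner (μ : Measure V) [IsFiniteMeasure μ] (ξ : V) :
    Integrable (fun x : V => Complex.exp ((⟪x, ξ⟫ : ℝ) * Complex.I)) μ :=
  Integrable.of_bound (by fun_prop) 1 (ae_of_all _ fun x => (Complex.norm_exp_ofReal_mul_I _).le)

theorem re_charFun (μ : Measure V) [IsFiniteMeasure μ] (ξ : V) :
    (charFun μ ξ).re = ∫ x, Real.cos ⟪x, ξ⟫ ∂μ := by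
  rw [charFun_apply]
  have := integral_re (integrable_cexp_inner μ ξ)
  simp only [RCLike.re_to_complex] at this
  rw [← this]
  simp only [Complex.exp_ofReal_mul_I_re]

theorem one_sub_re_charFun (μ : Measure V) [IsProbabilityMeasure μ] (ξ : V) :
    1 - (charFun μ ξ).re = ∫ x, (1 - Real.cos ⟪x, ξ⟫) ∂μ := by
  rw [integral_sub (integrable_const _)
    (Integrable.of_bound (by fun_prop) 1 (ae_of_all _ fun x => Real.abs_cos_le_one _)),
    ← re_charFun]
  simp

/-- Integrating `1 - cos (k x) ≤ k² (1 - cos x)`, which follows from `|sin (k y)| ≤ k |sin y|`. -/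
theorem one_sub_re_charFun_nat_smul_le (μ : Measure V) [IsProbabilityMeasure μ] (k : ℕ) (ξ : V) :
    1 - (charFun μ ((k : ℝ) • ξ)).re ≤ k ^ 2 * (1 - (charFun μ ξ).re) := by
  rw [one_sub_re_charFun, one_sub_re_charFun, ← integral_const_mul]
  have hb : ∀ η : V, Integrable (fun x : V => 1 - Real.cos ⟪x, η⟫) μ := fun η =>
    (integrable_const _).sub
      (Integrable.of_bound (by fun_prop) 1 (ae_of_all _ fun x => Real.abs_cos_le_one _))
  refine integral_mono (hb _) ((hb _).const_mul _) fun x => ?_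
  simp only [inner_smul_right]
  exact one_sub_cos_nat_mul_le k _

/-- A bound for `1 - Re φ` on the unit ball propagates to the whole space with quadratic growth. -/
theorem one_sub_re_charFun_le_of_closedBall (μ : Measure V) [IsProbabilityMeasure μ] {S : ℝ}
    (hS : ∀ η : V, ‖η‖ ≤ 1 → 1 - (charFun μ η).re ≤ S) (ξ : V) :
    1 - (charFun μ ξ).re ≤ S * (1 + ‖ξ‖) ^ 2 := by
  -- `ξ / k` lies in the unit ball, and `k ≤ 1 + ‖ξ‖`.
  set k : ℕ := ⌊‖ξ‖⌋₊ + 1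
  have hk0 : (0 : ℝ) < k := by positivity
  have hk1 : ‖ξ‖ ≤ k := by
    have := (Nat.lt_floor_add_one ‖ξ‖).le
    push_cast [k]
    exact this
  have hk2 : (k : ℝ) ≤ 1 + ‖ξ‖ := by
    have := Nat.floor_le (norm_nonneg ξ)
    push_cast [k]
    linarith
  have hS0 : 0 ≤ S := by
    have := hS 0 (by simp)
    simpa using this
  have h := one_sub_re_charFun_nat_smul_le μ k ((k : ℝ)⁻¹ • ξ)
  rw [smul_smul, mul_inv_cancel₀ hk0.ne', one_smul] at h
  have h2 : 1 - (charFun μ ((k : ℝ)⁻¹ • ξ)).re ≤ S := by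
    refine hS _ ?_
    rw [norm_smul, norm_inv, Real.norm_natCast, inv_mul_le_iff₀ hk0]
    simpa using hk1
  calc _ ≤ _ := h
    _ ≤ k ^ 2 * S := by gcongr
    _ ≤ (1 + ‖ξ‖) ^ 2 * S := by gcongr
    _ = _ := mul_comm _ _

theorem integral_one_sub_re_charFun_stdGaussian (μ : Measure V) [IsProbabilityMeasure μ] :
    ∫ ξ, (1 - (charFun μ ξ).re) ∂(stdGaussian V) =
      ∫ x, (1 - Real.exp (-(‖x‖ ^ 2 / 2))) ∂μ := by
  simp_rw [one_sub_re_charFun]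
  rw [integral_integral_swap]
  · refine integral_congr_ae (ae_of_all _ fun x => ?_)
    have := one_sub_re_charFun (stdGaussian V) x
    simp_rw [real_inner_comm] at this
    simp only
    rw [← this, charFun_stdGaussian]
    have e : (-(‖x‖ : ℂ) ^ 2 / 2) = ((-(‖x‖ ^ 2 / 2) : ℝ) : ℂ) := by push_cast; ring
    rw [e, Complex.exp_ofReal_re]
  · refine Integrable.of_bound (Continuous.aestronglyMeasurable (by fun_prop)) 2
      (ae_of_all _ fun z => ?_)
    have h1 := Real.cos_le_one ⟪z.2, z.1⟫
    have h2 := Real.neg_one_le_cos ⟪z.2, z.1⟫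
    simp only [Function.uncurry]
    rw [Real.norm_of_nonneg (by linarith)]
    linarith

theorem exists_integral_one_sub_exp_le (V : Type*) [NormedAddCommGroup V] [InnerProductSpace ℝ V]
    [FiniteDimensional ℝ V] [MeasurableSpace V] [BorelSpace V] :
    ∃ J : ℝ, 0 ≤ J ∧ ∀ (μ : Measure V) [IsProbabilityMeasure μ] (S : ℝ),
      (∀ η : V, ‖η‖ ≤ 1 → 1 - (charFun μ η).re ≤ S) →
      ∫ x, (1 - Real.exp (-(‖x‖ ^ 2 / 2))) ∂μ ≤ J * S := by
  have hJ : Integrable (fun ξ : V => (1 + ‖ξ‖) ^ 2) (stdGaussian V) := by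
    have hid : MemLp id 2 (stdGaussian V) := IsGaussian.memLp_two_id
    have h2 : MemLp (fun ξ : V => 1 + ‖ξ‖) 2 (stdGaussian V) :=
      (memLp_const (1 : ℝ)).add hid.norm
    exact h2.integrable_sq
  refine ⟨∫ ξ, (1 + ‖ξ‖) ^ 2 ∂(stdGaussian V), integral_nonneg fun ξ => by positivity,
    fun μ _ S hS => ?_⟩
  rw [← integral_one_sub_re_charFun_stdGaussian, mul_comm _ S, ← integral_const_mul]
  refine integral_mono ?_ (hJ.const_mul _) fun ξ => one_sub_re_charFun_le_of_closedBall μ hS ξ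
  refine (integrable_const _).sub (Integrable.of_bound (by fun_prop) 1 (ae_of_all _ fun ξ => ?_))
  exact (Complex.abs_re_le_norm _).trans (norm_charFun_le_one _)

/-- The values of `1 - Re φ` on the unit ball control both the truncated second moment and the mass
outside of the unit ball. Both integrands are at most `3 (1 - exp (-‖x‖ ^ 2 / 2))`, and the integral
of `1 - exp (-‖x‖ ^ 2 / 2)` is the Gaussian average of `1 - Re φ`. -/
theorem exists_tail_le (V : Type*) [NormedAddCommGroup V] [InnerProductSpace ℝ V]
    [FiniteDimensional ℝ V] [MeasurableSpace V] [BorelSpace V] :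
    ∃ C : ℝ, 0 ≤ C ∧ ∀ (μ : Measure V) [IsProbabilityMeasure μ] (S : ℝ),
      (∀ η : V, ‖η‖ ≤ 1 → 1 - (charFun μ η).re ≤ S) →
      ∫ x in Metric.closedBall 0 1, ‖x‖ ^ 2 ∂μ ≤ C * S ∧
      μ.real (Metric.closedBall 0 1)ᶜ ≤ C * S := by
  obtain ⟨J, hJ0, hJ⟩ := exists_integral_one_sub_exp_le V
  refine ⟨3 * J, by positivity, fun μ _ S hS => ?_⟩
  have hint : Integrable (fun x : V => 3 * (1 - Real.exp (-(‖x‖ ^ 2 / 2)))) μ := by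
    refine Integrable.of_bound (Continuous.aestronglyMeasurable (by fun_prop)) 3
      (ae_of_all _ fun x => ?_)
    have h1 : Real.exp (-(‖x‖ ^ 2 / 2)) ≤ 1 := Real.exp_le_one_iff.2 (by
      have := sq_nonneg ‖x‖; linarith)
    have h2 := Real.exp_pos (-(‖x‖ ^ 2 / 2))
    rw [Real.norm_of_nonneg (by linarith)]
    linarith
  have hnn : ∀ x : V, 0 ≤ 3 * (1 - Real.exp (-(‖x‖ ^ 2 / 2))) := fun x => by
    have h1 : Real.exp (-(‖x‖ ^ 2 / 2)) ≤ 1 := Real.exp_le_one_iff.2 (by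
      have := sq_nonneg ‖x‖; linarith)
    linarith
  have htot : ∫ x, 3 * (1 - Real.exp (-(‖x‖ ^ 2 / 2))) ∂μ ≤ 3 * J * S := by
    rw [integral_const_mul, mul_assoc]
    exact mul_le_mul_of_nonneg_left (hJ μ S hS) (by norm_num)
  have hle : ∀ x : V, 3 * (‖x‖ ^ 2 / 2 / (1 + ‖x‖ ^ 2 / 2)) ≤
      3 * (1 - Real.exp (-(‖x‖ ^ 2 / 2))) := fun x =>
    mul_le_mul_of_nonneg_left (div_one_add_le_one_sub_exp_neg (by positivity)) (by norm_num)
  constructor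
  · refine le_trans ?_ htot
    refine le_trans ?_ (setIntegral_le_integral (s := Metric.closedBall 0 1) hint
      (ae_of_all _ hnn))
    refine setIntegral_mono_on ?_ hint.integrableOn measurableSet_closedBall fun x hx => ?_
    · refine Measure.integrableOn_of_bounded (M := 1) (measure_ne_top _ _)
        (Continuous.aestronglyMeasurable (by fun_prop)) ?_
      refine (ae_restrict_iff' measurableSet_closedBall).2 (ae_of_all _ fun x hx => ?_)
      have hx' : ‖x‖ ≤ 1 := by simpa using hx
      rw [Real.norm_of_nonneg (by positivity)]
      exact pow_le_one₀ (norm_nonneg _) hx'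
    · refine le_trans ?_ (hle x)
      have hx' : ‖x‖ ≤ 1 := by simpa using hx
      have : ‖x‖ ^ 2 ≤ 1 := pow_le_one₀ (norm_nonneg _) hx'
      rw [← mul_div_assoc, le_div_iff₀ (by positivity)]
      nlinarith [sq_nonneg ‖x‖]
  · refine le_trans ?_ htot
    refine le_trans ?_ (setIntegral_le_integral (s := (Metric.closedBall 0 1)ᶜ) hint
      (ae_of_all _ hnn))
    have : μ.real (Metric.closedBall 0 1)ᶜ = ∫ x in (Metric.closedBall (0 : V) 1)ᶜ, (1 : ℝ) ∂μ := by
      simp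
    rw [this]
    refine setIntegral_mono_on (integrable_const _) hint.integrableOn
      measurableSet_closedBall.compl fun x hx => ?_
    refine le_trans ?_ (hle x)
    have hx' : 1 < ‖x‖ := by simpa using hx
    have : 1 ≤ ‖x‖ ^ 2 := one_le_pow₀ hx'.le
    rw [← mul_div_assoc, le_div_iff₀ (by positivity)]
    linarith

/-- The laws `μ t` are probability measures with characteristic functions `exp (- t ψ)`. These
are the one-dimensional marginals of a Lévy process. -/
structure HasExponent (μ : ℝ≥0 → Measure V) (ψ : V → ℂ) : Prop where
  prob : ∀ t, IsProbabilityMeasure (μ t)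
  charFun_eq : ∀ t ξ, charFun (μ t) ξ = Complex.exp (-((t : ℝ) : ℂ) * ψ ξ)

namespace HasExponent

variable {μ : ℝ≥0 → Measure V} {ψ : V → ℂ} (h : HasExponent μ ψ)
include h

omit [FiniteDimensional ℝ V] [BorelSpace V] in
theorem re_nonneg (ξ : V) : 0 ≤ (ψ ξ).re := by
  have := h.prob 1
  have h1 := norm_charFun_le_one (μ := μ 1) (t := ξ)
  rw [h.charFun_eq, Complex.norm_exp] at h1
  simpa using h1

/-- The exponent is recovered from the resolvent: `1 / (1 + ψ) = ∫ e⁻ˢ e^{-s ψ} ds` over `s > 0`,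
which is continuous as a mixture of characteristic functions. No choice of a logarithm is needed. -/
theorem continuous : Continuous ψ := by
  have hre := h.re_nonneg
  have hne : ∀ ξ, 1 + ψ ξ ≠ 0 := fun ξ h0 => by
    have := congrArg Complex.re h0
    simp at this
    linarith [hre ξ]
  have hR : Continuous fun ξ => ∫ s : ℝ in Set.Ioi 0, Complex.exp (-(1 + ψ ξ) * s) := by
    refine continuous_of_dominated (bound := fun s : ℝ => Real.exp (-s))
      (fun ξ => Continuous.aestronglyMeasurable (by fun_prop)) (fun ξ => ?_)
      (integrableOn_exp_neg_Ioi 0) ?_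
    · refine (ae_restrict_iff' measurableSet_Ioi).2 (ae_of_all _ fun s hs => ?_)
      have hs' : 0 < s := hs
      rw [Complex.norm_exp]
      refine Real.exp_le_exp.2 ?_
      simp
      nlinarith [hre ξ, mul_nonneg (hre ξ) hs'.le]
    · refine (ae_restrict_iff' measurableSet_Ioi).2 (ae_of_all _ fun s hs => ?_)
      have hs' : 0 < s := hs
      have := h.prob s.toNNReal
      have e : (fun ξ => Complex.exp (-(1 + ψ ξ) * s)) =
          fun ξ => Complex.exp (-s) * charFun (μ s.toNNReal) ξ := by
        ext ξ
        rw [h.charFun_eq, Real.coe_toNNReal _ hs'.le, ← Complex.exp_add]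
        congr 1
        ring
      rw [e]
      fun_prop
  have hR2 : ∀ ξ, ∫ s : ℝ in Set.Ioi 0, Complex.exp (-(1 + ψ ξ) * s) = (1 + ψ ξ)⁻¹ := fun ξ => by
    rw [integral_exp_mul_complex_Ioi (by simp; linarith [hre ξ]), neg_div_neg_eq]
    simp
  simp_rw [hR2] at hR
  have := hR.inv₀ fun ξ => inv_ne_zero (hne ξ)
  refine (this.sub (continuous_const (y := (1 : ℂ)))).congr fun ξ => ?_
  simp

omit [FiniteDimensional ℝ V] [BorelSpace V] in
theorem one_sub_re_charFun_le {B : ℝ} (hB : ∀ η : V, ‖η‖ ≤ 1 → ‖ψ η‖ ≤ B) (t : ℝ≥0) (η : V)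
    (hη : ‖η‖ ≤ 1) : 1 - (charFun (μ t) η).re ≤ t * B := by
  have h1 : 1 - (charFun (μ t) η).re ≤ ‖1 - Complex.exp (-((t : ℝ) * ψ η))‖ := by
    rw [h.charFun_eq]
    refine le_trans (le_of_eq ?_) (Complex.re_le_norm _)
    simp
  refine (h1.trans (norm_one_sub_cexp_neg_le ?_)).trans ?_
  · rw [Complex.re_ofReal_mul]
    exact mul_nonneg t.2 (h.re_nonneg η)
  · rw [norm_mul, Complex.norm_real, Real.norm_of_nonneg (NNReal.coe_nonneg t)]
    exact mul_le_mul_of_nonneg_left (hB η hη) t.2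

/-- The real part of an exponent grows at most quadratically. -/
theorem re_le {B : ℝ} (hB : ∀ η : V, ‖η‖ ≤ 1 → ‖ψ η‖ ≤ B) (ξ : V) :
    (ψ ξ).re ≤ 2 * B * (1 + ‖ξ‖) ^ 2 := by
  rcases (h.re_nonneg ξ).eq_or_lt with h0 | h0
  · rw [← h0]
    have := (norm_nonneg _).trans (hB 0 (by simp))
    positivity
  -- At the time `s = 1 / Re ψ ξ` the characteristic function at `ξ` has modulus `1 / e ≤ 1 / 2`.
  set s : ℝ≥0 := ((ψ ξ).re⁻¹).toNNReal
  have hs : (s : ℝ) = (ψ ξ).re⁻¹ := Real.coe_toNNReal _ (by positivity)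
  have := h.prob s
  have h1 := one_sub_re_charFun_le_of_closedBall (μ s) (h.one_sub_re_charFun_le hB s) ξ
  have h2 : (charFun (μ s) ξ).re ≤ 1 / 2 := by
    refine (Complex.re_le_norm _).trans ?_
    rw [h.charFun_eq, Complex.norm_exp, ← Complex.ofReal_neg, Complex.re_ofReal_mul, hs, neg_mul,
      inv_mul_cancel₀ h0.ne', Real.exp_neg, one_div]
    exact inv_anti₀ (by norm_num) (by linarith [Real.add_one_le_exp 1])
  rw [hs] at h1
  have h3 : 1 / 2 ≤ (ψ ξ).re⁻¹ * B * (1 + ‖ξ‖) ^ 2 := by linarith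
  rw [mul_assoc, inv_mul_eq_div, le_div_iff₀ h0] at h3
  linarith

end HasExponent

end Exponent

/-! ### Derivatives of the exponent of the small jumps -/

section SmallJumps

open scoped RealInnerProductSpace ContDiff

variable {V : Type*} [NormedAddCommGroup V] [InnerProductSpace ℝ V] [FiniteDimensional ℝ V]
  [MeasurableSpace V] [BorelSpace V]

theorem memLp_id_of_ae_norm_le_one {ν : Measure V} [IsFiniteMeasure ν]
    (hν : ∀ᵐ x ∂ν, ‖x‖ ≤ 1) (p : ℝ≥0∞) : MemLp id p ν :=
  MemLp.of_bound aestronglyMeasurable_id 1 hν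

theorem contDiff_charFun_of_ae_norm_le_one {ν : Measure V} [IsFiniteMeasure ν]
    (hν : ∀ᵐ x ∂ν, ‖x‖ ≤ 1) : ContDiff ℝ ∞ (charFun ν) :=
  contDiff_charFun' fun k => memLp_id_of_ae_norm_le_one hν k

/-- For jumps of size at most one, all absolute moments of order at least two are bounded by the
second moment, and these moments bound the derivatives. -/
theorem norm_iteratedFDeriv_charFun_le_of_two_le {ν : Measure V} [IsFiniteMeasure ν]
    (hν : ∀ᵐ x ∂ν, ‖x‖ ≤ 1) {j : ℕ} (hj : 2 ≤ j) (ξ : V) :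
    ‖iteratedFDeriv ℝ j (charFun ν) ξ‖ ≤ ∫ x, ‖x‖ ^ 2 ∂ν := by
  refine ContinuousMultilinearMap.opNorm_le_bound (integral_nonneg fun x => by positivity)
    fun m => ?_
  rw [iteratedFDeriv_charFun (memLp_id_of_ae_norm_le_one hν _), norm_mul, norm_pow, Complex.norm_I,
    one_pow, one_mul, ← integral_mul_const]
  refine norm_integral_le_of_norm_le (Integrable.mul_const ?_ _) ?_
  · exact (memLp_id_of_ae_norm_le_one hν 2).integrable_norm_pow (by norm_num)
  · filter_upwards [hν] with x hx
    rw [norm_mul, Complex.norm_exp_ofReal_mul_I, mul_one, Complex.ofReal_prod, norm_prod]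
    calc ∏ i, ‖((⟪x, m i⟫ : ℝ) : ℂ)‖ ≤ ∏ i, (‖x‖ * ‖m i‖) := by
          refine Finset.prod_le_prod (fun i _ => norm_nonneg _) fun i _ => ?_
          rw [Complex.norm_real]
          exact abs_real_inner_le_norm _ _
      _ = ‖x‖ ^ j * ∏ i, ‖m i‖ := by
          rw [Finset.prod_mul_distrib, Finset.prod_const, Finset.card_univ, Fintype.card_fin]
      _ ≤ _ := by
          gcongr ?_ * _
          exact pow_le_pow_of_le_one (norm_nonneg _) hx hj

theorem norm_fderiv_charFun_sub_le {ν : Measure V} [IsFiniteMeasure ν]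
    (hν : ∀ᵐ x ∂ν, ‖x‖ ≤ 1) (ξ : V) :
    ‖fderiv ℝ (charFun ν) ξ - fderiv ℝ (charFun ν) 0‖ ≤ (∫ x, ‖x‖ ^ 2 ∂ν) * ‖ξ‖ := by
  have hc := contDiff_charFun_of_ae_norm_le_one hν
  have hd : Differentiable ℝ (fderiv ℝ (charFun ν)) :=
    (hc.fderiv_right (m := ∞) (by simp)).differentiable (by simp)
  have := convex_univ.norm_image_sub_le_of_norm_fderiv_le (𝕜 := ℝ) (f := fderiv ℝ (charFun ν))
    (C := ∫ x, ‖x‖ ^ 2 ∂ν) (x := 0) (y := ξ) (fun x _ => hd x) (fun x _ => ?_) trivial trivial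
  · simpa using this
  · rw [← norm_iteratedFDeriv_one, norm_iteratedFDeriv_fderiv]
    exact norm_iteratedFDeriv_charFun_le_of_two_le hν le_rfl x

/-- The constants involve neither the mass nor the first moment of `ν`, which may blow up along
the approximation. The first derivative is controlled through the values on the unit ball. -/
theorem norm_iteratedFDeriv_charFun_le {ν : Measure V} [IsFiniteMeasure ν]
    (hν : ∀ᵐ x ∂ν, ‖x‖ ≤ 1) {C B : ℝ} (hC : ∫ x, ‖x‖ ^ 2 ∂ν ≤ C)
    (hB : ∀ ξ : V, ‖ξ‖ ≤ 1 → ‖ν.real Set.univ - charFun ν ξ‖ ≤ B) {j : ℕ} (hj : 1 ≤ j) (ξ : V) :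
    ‖iteratedFDeriv ℝ j (charFun ν) ξ‖ ≤ (B + 2 * C) * (1 + ‖ξ‖) := by
  have hC0 : 0 ≤ C := le_trans (integral_nonneg fun x => by positivity) hC
  have hB0 : 0 ≤ B := (norm_nonneg _).trans (hB 0 (by simp))
  rcases hj.eq_or_lt with rfl | hj2
  · have hc := contDiff_charFun_of_ae_norm_le_one hν
    have hsub : ∀ η : V, ‖fderiv ℝ (charFun ν) η - fderiv ℝ (charFun ν) 0‖ ≤ C * ‖η‖ := fun η =>
      (norm_fderiv_charFun_sub_le hν η).trans (by gcongr)
    -- The derivative at the origin is recovered from the values on the unit sphere.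
    have h0 : ‖fderiv ℝ (charFun ν) 0‖ ≤ B + C := by
      refine ContinuousLinearMap.opNorm_le_of_unit_norm (by positivity) fun v hv => ?_
      have h1 := (convex_closedBall (0 : V) 1).norm_image_sub_le_of_norm_fderiv_le' (𝕜 := ℝ)
        (f := charFun ν) (φ := fderiv ℝ (charFun ν) 0) (C := C) (x := 0) (y := v)
        (fun x _ => hc.differentiable (by simp) x) (fun x hx => ?_) (by simp) (by simp [hv])
      · have h2 := hB v hv.le
        rw [sub_zero, hv, mul_one, charFun_zero] at h1
        have h3 : fderiv ℝ (charFun ν) 0 v = -(charFun ν v - ν.real Set.univ -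
            fderiv ℝ (charFun ν) 0 v) - (ν.real Set.univ - charFun ν v) := by ring
        rw [h3]
        refine (norm_sub_le _ _).trans ?_
        rw [norm_neg]
        linarith
      · refine (hsub x).trans (mul_le_of_le_one_right hC0 (by simpa using hx))
    rw [norm_iteratedFDeriv_one]
    have h4 := norm_le_norm_add_norm_sub' (fderiv ℝ (charFun ν) ξ) (fderiv ℝ (charFun ν) 0)
    have h5 := hsub ξ
    nlinarith [norm_nonneg ξ, mul_nonneg hB0 (norm_nonneg ξ), mul_nonneg hC0 (norm_nonneg ξ)]
  · refine (norm_iteratedFDeriv_charFun_le_of_two_le hν hj2 ξ).trans (hC.trans ?_)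
    nlinarith [norm_nonneg ξ, mul_nonneg hB0 (norm_nonneg ξ), mul_nonneg hC0 (norm_nonneg ξ)]

/-- Polynomial bounds for the derivatives of the exponent of the small jumps with an added Gaussian
term, uniform in `ν` and in `ε ≤ 1`. -/
theorem exists_smallJumps_bound (V : Type*) [NormedAddCommGroup V] [InnerProductSpace ℝ V]
    [FiniteDimensional ℝ V] [MeasurableSpace V] [BorelSpace V] (t B C : ℝ) (N : ℕ) :
    ∃ (k : ℕ) (A : ℝ), ∀ (ν : Measure V) [IsFiniteMeasure ν], (∀ᵐ x ∂ν, ‖x‖ ≤ 1) →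
      ∫ x, ‖x‖ ^ 2 ∂ν ≤ C →
      (∀ ξ : V, ‖ξ‖ ≤ 1 → ‖ν.real Set.univ - charFun ν ξ‖ ≤ B) →
      ∀ ε : ℝ, 0 ≤ ε → ε ≤ 1 → ∀ j, 1 ≤ j → j ≤ N → ∀ ξ,
        ‖iteratedFDeriv ℝ j (fun ξ => (t : ℂ) * (charFun ν ξ - ν.real Set.univ) -
          ((t * ε * ‖ξ‖ ^ 2 : ℝ) : ℂ)) ξ‖ ≤ A * (1 + ‖ξ‖) ^ k := by
  have htg : (fun ξ : V => ((‖ξ‖ ^ 2 : ℝ) : ℂ)).HasTemperateGrowth := by fun_prop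
  obtain ⟨k, D, hD0, hD⟩ := htg.norm_iteratedFDeriv_le_uniform N
  refine ⟨k + 1, |t| * (B + 2 * C) + |t| * D, fun ν _ hν hC hB ε hε hε1 j hj hjN ξ => ?_⟩
  have hC0 : 0 ≤ C := le_trans (integral_nonneg fun x => by positivity) hC
  have hB0 : 0 ≤ B := (norm_nonneg _).trans (hB 0 (by simp))
  have hc := contDiff_charFun_of_ae_norm_le_one hν
  have e : (fun ξ => (t : ℂ) * (charFun ν ξ - ν.real Set.univ) - ((t * ε * ‖ξ‖ ^ 2 : ℝ) : ℂ)) =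
      (fun _ => -(t : ℂ) * ν.real Set.univ) + ((t : ℂ) • charFun ν +
        (-(t * ε : ℝ) : ℂ) • fun ξ : V => ((‖ξ‖ ^ 2 : ℝ) : ℂ)) := by
    ext ξ
    simp only [Pi.add_apply, Pi.smul_apply, smul_eq_mul]
    push_cast
    ring
  have hcj : ContDiff ℝ j (charFun ν) := hc.of_le (by exact_mod_cast le_top)
  have hqj : ContDiff ℝ j (fun ξ : V => ((‖ξ‖ ^ 2 : ℝ) : ℂ)) :=
    htg.1.of_le (by exact_mod_cast le_top)
  have hcj' : ContDiff ℝ j ((t : ℂ) • charFun ν) := contDiff_const.smul hcj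
  have hqj' : ContDiff ℝ j ((-(t * ε : ℝ) : ℂ) • fun ξ : V => ((‖ξ‖ ^ 2 : ℝ) : ℂ)) :=
    contDiff_const.smul hqj
  have hs : ContDiff ℝ j ((t : ℂ) • charFun ν +
      (-(t * ε : ℝ) : ℂ) • fun ξ : V => ((‖ξ‖ ^ 2 : ℝ) : ℂ)) := hcj'.add hqj'
  rw [e, iteratedFDeriv_add_apply contDiff_const.contDiffAt hs.contDiffAt,
    iteratedFDeriv_add_apply hcj'.contDiffAt hqj'.contDiffAt,
    iteratedFDeriv_const_smul_apply hcj.contDiffAt, iteratedFDeriv_const_smul_apply hqj.contDiffAt,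
    iteratedFDeriv_const_of_ne (by omega), Pi.zero_apply, zero_add]
  have hx : 1 ≤ 1 + ‖ξ‖ := by simp
  have h1 : ‖(t : ℂ) • iteratedFDeriv ℝ j (charFun ν) ξ‖ ≤
      |t| * ((B + 2 * C) * (1 + ‖ξ‖) ^ (k + 1)) := by
    rw [norm_smul, Complex.norm_real, Real.norm_eq_abs]
    refine mul_le_mul_of_nonneg_left ?_ (abs_nonneg _)
    refine (norm_iteratedFDeriv_charFun_le hν hC hB hj ξ).trans ?_
    gcongr
    exact le_self_pow₀ hx (by omega)
  have h2 : ‖(-(t * ε : ℝ) : ℂ) • iteratedFDeriv ℝ j (fun ξ : V => ((‖ξ‖ ^ 2 : ℝ) : ℂ)) ξ‖ ≤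
      |t| * (D * (1 + ‖ξ‖) ^ (k + 1)) := by
    rw [norm_smul, norm_neg, Complex.norm_real, Real.norm_eq_abs, abs_mul, abs_of_nonneg hε]
    have := hD j hjN ξ
    calc _ ≤ |t| * 1 * (D * (1 + ‖ξ‖) ^ k) := by gcongr
      _ ≤ |t| * 1 * (D * (1 + ‖ξ‖) ^ (k + 1)) := by
        gcongr
        omega
      _ = _ := by ring
  refine (norm_add_le _ _).trans ((add_le_add h1 h2).trans (le_of_eq ?_))
  ring

end SmallJumps

/-! ### The approximating exponents -/

section Truncation

theorem half_le_mul_one_sub_exp_neg_div {a k : ℝ} (ha : 0 ≤ a) (hk : 0 < k) (hak : a ≤ k) :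
    a / 2 ≤ k * (1 - Real.exp (-(a / k))) := by
  have h1 := div_one_add_le_one_sub_exp_neg (y := a / k) (by positivity)
  have h2 : a / k ≤ 1 := (div_le_one hk).2 hak
  have h3 : a / k / 2 ≤ a / k / (1 + a / k) := by
    gcongr
    linarith
  calc a / 2 = k * (a / k / 2) := by field_simp
    _ ≤ _ := by
      gcongr
      exact h3.trans h1

theorem exists_pow_le_mul_exp_div_one_add {c : ℝ} (hc : 0 < c) (M : ℕ) :
    ∃ D : ℝ, ∀ r : ℝ, 0 ≤ r → (1 + r) ^ M ≤ D * Real.exp (c * (r ^ 2 / (1 + r))) := by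
  refine ⟨M.factorial * (2 / c) ^ M * Real.exp c, fun r hr => ?_⟩
  have h1 : c / 2 * (1 + r) ≤ c + c * (r ^ 2 / (1 + r)) := by
    have : (1 + r) / 2 ≤ 1 + r ^ 2 / (1 + r) := by
      rw [← sub_le_iff_le_add', le_div_iff₀ (by positivity)]
      nlinarith [sq_nonneg r]
    nlinarith
  have h2 := Real.pow_div_factorial_le_exp (c / 2 * (1 + r)) (by positivity) M
  rw [div_le_iff₀ (by positivity)] at h2
  have h3 : (1 + r) ^ M = (2 / c) ^ M * (c / 2 * (1 + r)) ^ M := by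
    rw [← mul_pow]
    congr 1
    field_simp
  rw [h3]
  calc _ ≤ (2 / c) ^ M * (Real.exp (c / 2 * (1 + r)) * M.factorial) := by gcongr
    _ ≤ (2 / c) ^ M * (Real.exp (c + c * (r ^ 2 / (1 + r))) * M.factorial) := by gcongr
    _ = _ := by rw [Real.exp_add]; ring

theorem tendsto_mul_one_sub_cexp_neg_div (z : ℂ) :
    Tendsto (fun k : ℕ => ((k + 1 : ℝ) ^ 2 : ℂ) * (1 - Complex.exp (-(z / ((k + 1 : ℝ) ^ 2 : ℂ)))))
      atTop (𝓝 z) := by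
  -- The expression is the difference quotient at `0`, with increment `(k + 1)⁻²`, of this function.
  have hd : HasDerivAt (fun s : ℂ => 1 - Complex.exp (-(s * z))) z 0 := by
    have := (((hasDerivAt_id (0 : ℂ)).mul_const z).neg.cexp).const_sub 1
    simpa using this
  have hs := hd.tendsto_slope_zero
  have hk : Tendsto (fun k : ℕ => (((k + 1 : ℝ) ^ 2 : ℂ))⁻¹) atTop (𝓝[≠] 0) := by
    refine tendsto_nhdsWithin_iff.2 ⟨?_, Eventually.of_forall fun k => ?_⟩
    · have h1 : Tendsto (fun k : ℕ => ((k : ℝ) + 1) ^ 2) atTop atTop :=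
        (tendsto_pow_atTop (by norm_num)).comp
          (tendsto_atTop_add_const_right _ _ tendsto_natCast_atTop_atTop)
      have h2 := (Complex.continuous_ofReal.tendsto 0).comp (tendsto_inv_atTop_zero.comp h1)
      refine (h2.congr fun k => ?_)
      simp
    · have : ((k : ℂ) + 1) ≠ 0 := by exact_mod_cast Nat.succ_ne_zero k
      simp [this]
  refine (hs.comp hk).congr fun k => ?_
  simp [div_eq_inv_mul]

end Truncation

/-! ### Integrability of the Fourier transform of `q * exp (-t ψ)` -/

section KeyEstimate

open scoped RealInnerProductSpace ContDiff FourierTransform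

variable {V : Type*} [NormedAddCommGroup V] [InnerProductSpace ℝ V] [FiniteDimensional ℝ V]
  [MeasurableSpace V] [BorelSpace V]

omit [FiniteDimensional ℝ V] [BorelSpace V] in
theorem charFun_nnreal_smul (μ : Measure V) (c : ℝ≥0) (ξ : V) :
    charFun (c • μ) ξ = (c : ℝ) * charFun μ ξ := by
  rw [charFun_apply, integral_smul_nnreal_measure, ← charFun_apply, NNReal.smul_def,
    Complex.real_smul]

theorem charFun_restrict_add_compl (μ : Measure V) [IsFiniteMeasure μ] {s : Set V}
    (hs : MeasurableSet s) (ξ : V) :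
    charFun (μ.restrict s) ξ + charFun (μ.restrict sᶜ) ξ = charFun μ ξ := by
  simp only [charFun_apply]
  exact integral_add_compl hs (integrable_cexp_inner μ ξ)

omit [FiniteDimensional ℝ V] [BorelSpace V] in
theorem norm_measureReal_sub_charFun_le (ν : Measure V) [IsFiniteMeasure ν] (ξ : V) :
    ‖(ν.real Set.univ : ℂ) - charFun ν ξ‖ ≤ 2 * ν.real Set.univ := by
  refine (norm_sub_le _ _).trans ?_
  rw [Complex.norm_real, Real.norm_of_nonneg measureReal_nonneg]
  linarith [norm_charFun_le (μ := ν) ξ]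

namespace HasExponent

variable {μ : ℝ≥0 → Measure V} {ψ : V → ℂ} (h : HasExponent μ ψ)
include h

theorem exists_norm_le : ∃ B : ℝ, 0 ≤ B ∧ ∀ η : V, ‖η‖ ≤ 1 → ‖ψ η‖ ≤ B := by
  obtain ⟨B, hB⟩ := (isCompact_closedBall (0 : V) 1).exists_bound_of_continuousOn
    h.continuous.continuousOn
  have hB' : ∀ η : V, ‖η‖ ≤ 1 → ‖ψ η‖ ≤ B := fun η hη => hB η (by simpa using hη)
  exact ⟨B, (norm_nonneg _).trans (hB' 0 (by simp)), hB'⟩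

/-- The approximating exponent `r (1 - exp (-ψ / r))` is that of the compound Poisson law with jump
measure `r • μ r⁻¹`. Its restriction `ν₁` to the unit ball has bounded second moment, and its
restriction `ν₂` to the complement has bounded mass, with a bound independent of `r`. -/
theorem exists_jump_decomposition :
    ∃ C : ℝ, 0 ≤ C ∧ ∀ r : ℝ≥0, 0 < r → ∃ ν₁ ν₂ : Measure V, IsFiniteMeasure ν₁ ∧
      IsFiniteMeasure ν₂ ∧ (∀ᵐ x ∂ν₁, ‖x‖ ≤ 1) ∧ ∫ x, ‖x‖ ^ 2 ∂ν₁ ≤ C ∧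
      ν₂.real Set.univ ≤ C ∧
      ∀ ξ, ((r : ℝ) : ℂ) * (1 - Complex.exp (-(ψ ξ / (r : ℝ)))) =
        (ν₁.real Set.univ - charFun ν₁ ξ) + (ν₂.real Set.univ - charFun ν₂ ξ) := by
  obtain ⟨B, hB0, hB⟩ := h.exists_norm_le
  obtain ⟨J, hJ0, hJ⟩ := exists_tail_le V
  refine ⟨J * B, by positivity, fun r hr => ?_⟩
  have := h.prob r⁻¹
  obtain ⟨h1, h2⟩ := hJ (μ r⁻¹) (((r⁻¹ : ℝ≥0) : ℝ) * B) (h.one_sub_re_charFun_le hB r⁻¹)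
  have e : (r : ℝ) * (J * (((r⁻¹ : ℝ≥0) : ℝ) * B)) = J * B := by
    rw [NNReal.coe_inv]
    field_simp
  refine ⟨(r • μ r⁻¹).restrict (Metric.closedBall 0 1),
    (r • μ r⁻¹).restrict (Metric.closedBall 0 1)ᶜ, inferInstance, inferInstance, ?_, ?_, ?_, ?_⟩
  · refine (ae_restrict_iff' measurableSet_closedBall).2 (ae_of_all _ fun x hx => by simpa using hx)
  · rw [Measure.restrict_smul, integral_smul_nnreal_measure, NNReal.smul_def, smul_eq_mul, ← e]
    gcongr
  · rw [measureReal_restrict_apply_univ, measureReal_nnreal_smul_apply, ← e]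
    gcongr
  · intro ξ
    have hc := charFun_restrict_add_compl (r • μ r⁻¹)
      (measurableSet_closedBall (x := (0 : V)) (ε := 1)) ξ
    have hm : ((r • μ r⁻¹).restrict (Metric.closedBall (0 : V) 1)).real Set.univ +
        ((r • μ r⁻¹).restrict (Metric.closedBall (0 : V) 1)ᶜ).real Set.univ = r := by
      rw [measureReal_restrict_apply_univ, measureReal_restrict_apply_univ,
        measureReal_add_measureReal_compl measurableSet_closedBall, measureReal_nnreal_smul_apply]
      simp
    rw [charFun_nnreal_smul, h.charFun_eq] at hc
    have hm' := congrArg (fun x : ℝ => (x : ℂ)) hm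
    simp only [Complex.ofReal_add] at hm'
    have e2 : -(ψ ξ / ((r : ℝ) : ℂ)) = -(((r⁻¹ : ℝ≥0) : ℝ) : ℂ) * ψ ξ := by
      rw [NNReal.coe_inv, Complex.ofReal_inv]
      ring
    rw [e2, mul_sub, mul_one, ← hc, ← hm']
    ring

/-- The decay of `exp (-t ψ)` is inherited, uniformly in `k`, by the approximating exponents with an
added Gaussian term. As these exponents are bounded by `2 (k + 1)²` the Gaussian term cannot be
dispensed with; its coefficient `(k + 1)⁻¹` is large enough for the `ξ` where it matters. -/
theorem exists_approx_decay
    (hdec : ∀ t : ℝ, 0 < t → ∀ M : ℕ, ∃ C : ℝ, ∀ ξ, (1 + ‖ξ‖) ^ M ≤ C * Real.exp (t * (ψ ξ).re))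
    {t : ℝ} (ht : 0 < t) (M : ℕ) :
    ∃ D : ℝ, ∀ (k : ℕ) (ξ : V), (1 + ‖ξ‖) ^ M ≤
      D * Real.exp (t * ((((k + 1 : ℝ) ^ 2 : ℂ) *
        (1 - Complex.exp (-(ψ ξ / ((k + 1 : ℝ) ^ 2 : ℂ))))).re + (k + 1 : ℝ)⁻¹ * ‖ξ‖ ^ 2)) := by
  obtain ⟨B, hB0, hB⟩ := h.exists_norm_le
  obtain ⟨D₁, hD₁⟩ := hdec (t / 2) (by positivity) M
  set c : ℝ := √(2 * B) + 1
  have hcB : 2 * B ≤ c ^ 2 := by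
    have := Real.sq_sqrt (show 0 ≤ 2 * B by positivity)
    nlinarith [Real.sqrt_nonneg (2 * B)]
  obtain ⟨D₂, hD₂⟩ := exists_pow_le_mul_exp_div_one_add (c := t / c) (by positivity) M
  refine ⟨max D₁ D₂, fun k ξ => ?_⟩
  set n : ℝ := (k + 1 : ℝ) with hn
  set a := (ψ ξ).re with ha
  have ha0 : 0 ≤ a := h.re_nonneg ξ
  have hre : n ^ 2 * (1 - Real.exp (-(a / n ^ 2))) ≤
      (((n : ℂ) ^ 2) * (1 - Complex.exp (-(ψ ξ / ((n : ℂ) ^ 2))))).re := by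
    rw [← Complex.ofReal_pow, Complex.re_ofReal_mul]
    refine mul_le_mul_of_nonneg_left ?_ (by positivity)
    rw [Complex.sub_re, Complex.one_re]
    have h1 := Complex.re_le_norm (Complex.exp (-(ψ ξ / ((n ^ 2 : ℝ) : ℂ))))
    rw [Complex.norm_exp, Complex.neg_re, Complex.div_ofReal_re] at h1
    linarith
  have hexp : ∀ u : ℝ, 0 ≤ u → 0 ≤ n ^ 2 * (1 - Real.exp (-(u / n ^ 2))) := fun u hu => by
    have : Real.exp (-(u / n ^ 2)) ≤ 1 := Real.exp_le_one_iff.2 (by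
      have : 0 ≤ u / n ^ 2 := by positivity
      linarith)
    positivity
  have hD0 : 0 ≤ max D₁ D₂ := by
    have h1 := hD₂ 0 le_rfl
    simp at h1
    exact le_max_of_le_right (by linarith)
  -- If `Re ψ ξ ≤ n²`, the approximating exponent has real part at least `Re ψ ξ / 2`. Otherwise the
  -- quadratic growth of `Re ψ` forces `n ≤ c (1 + ‖ξ‖)`, and the Gaussian term suffices.
  rcases le_or_gt a (n ^ 2) with hle | hlt
  · have h1 := half_le_mul_one_sub_exp_neg_div ha0 (show 0 < n ^ 2 by positivity) hle
    refine (hD₁ ξ).trans ?_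
    refine mul_le_mul (le_max_left _ _) (Real.exp_le_exp.2 ?_) (Real.exp_pos _).le hD0
    · have : 0 ≤ n⁻¹ * ‖ξ‖ ^ 2 := by positivity
      rw [← ha]
      calc t / 2 * a = t * (a / 2) := by ring
        _ ≤ _ := by
          gcongr
          exact le_add_of_le_of_nonneg (h1.trans hre) this
  · have h1 : n ^ 2 ≤ (c * (1 + ‖ξ‖)) ^ 2 := by
      rw [mul_pow]
      refine hlt.le.trans ((h.re_le hB ξ).trans ?_)
      gcongr
    have h2 : n ≤ c * (1 + ‖ξ‖) := le_of_sq_le_sq h1 (by positivity)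
    refine (hD₂ ‖ξ‖ (norm_nonneg _)).trans ?_
    refine mul_le_mul (le_max_right _ _) (Real.exp_le_exp.2 ?_) (Real.exp_pos _).le hD0
    · have h3 : ‖ξ‖ ^ 2 / (c * (1 + ‖ξ‖)) ≤ n⁻¹ * ‖ξ‖ ^ 2 := by
        rw [inv_mul_eq_div]
        gcongr
      calc t / c * (‖ξ‖ ^ 2 / (1 + ‖ξ‖)) = t * (‖ξ‖ ^ 2 / (c * (1 + ‖ξ‖))) := by field_simp
        _ ≤ _ := by
          gcongr
          exact le_add_of_nonneg_of_le ((hexp a ha0).trans hre) h3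

/-- The `L¹` bound for the approximating exponents, uniform in `k`. -/
theorem exists_lintegral_fourier_approx_le
    (hdec : ∀ t : ℝ, 0 < t → ∀ M : ℕ, ∃ C : ℝ, ∀ ξ, (1 + ‖ξ‖) ^ M ≤ C * Real.exp (t * (ψ ξ).re))
    {q : V → ℂ} (hq : q.HasTemperateGrowth) {t : ℝ} (ht : 0 < t) :
    ∃ A : ℝ≥0, ∀ k : ℕ, ∫⁻ x, ‖𝓕 (fun ξ => q ξ * Complex.exp (-t * (((k + 1 : ℝ) ^ 2 : ℂ) *
        (1 - Complex.exp (-(ψ ξ / ((k + 1 : ℝ) ^ 2 : ℂ)))) + ((k + 1 : ℝ)⁻¹ * ‖ξ‖ ^ 2 : ℝ)))) x‖ₑ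
      ≤ A := by
  obtain ⟨B, hB0, hB⟩ := h.exists_norm_le
  obtain ⟨C, hC0, hC⟩ := h.exists_jump_decomposition
  choose D hD using h.exists_approx_decay hdec ht
  obtain ⟨m, A₀, hA₀⟩ := exists_smallJumps_bound V t (B + 2 * C) C (Module.finrank ℝ V + 1)
  obtain ⟨A, hA⟩ := exists_lintegral_fourier_mul_cexp_le hq m A₀
    fun M => D M * Real.exp (t * (2 * C))
  refine ⟨A, fun k => ?_⟩
  set n : ℝ := (k + 1 : ℝ) with hn
  have hn0 : 0 < n := by positivity
  have hn1 : 1 ≤ n := by simp [hn]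
  obtain ⟨ν₁, ν₂, _, _, hν, hν₁, hν₂, hdecomp⟩ := hC (n ^ 2).toNNReal
    (Real.toNNReal_pos.2 (by positivity))
  simp only [Real.coe_toNNReal _ (sq_nonneg n), Complex.ofReal_pow] at hdecomp
  have hν₂' : ∀ ξ, ‖(ν₂.real Set.univ : ℂ) - charFun ν₂ ξ‖ ≤ 2 * C := fun ξ =>
    (norm_measureReal_sub_charFun_le ν₂ ξ).trans (by linarith)
  set Ψ : V → ℂ := fun ξ => (n : ℂ) ^ 2 * (1 - Complex.exp (-(ψ ξ / (n : ℂ) ^ 2))) with hΨ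
  have hΨB : ∀ ξ, ‖Ψ ξ‖ ≤ ‖ψ ξ‖ := fun ξ => by
    have h1 := norm_one_sub_cexp_neg_le (z := ψ ξ / (n : ℂ) ^ 2) (by
      rw [← Complex.ofReal_pow, Complex.div_ofReal_re]
      exact div_nonneg (h.re_nonneg ξ) (by positivity))
    rw [norm_div, norm_pow, Complex.norm_real, Real.norm_of_nonneg hn0.le,
      le_div_iff₀ (by positivity)] at h1
    rw [hΨ, norm_mul, norm_pow, Complex.norm_real, Real.norm_of_nonneg hn0.le, mul_comm]
    exact h1
  have hν₁' : ∀ ξ, (ν₁.real Set.univ : ℂ) - charFun ν₁ ξ =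
      Ψ ξ - (ν₂.real Set.univ - charFun ν₂ ξ) := fun ξ => by
    rw [hΨ]
    simp only [hdecomp]
    ring
  -- `G` is the part of the exponent that comes from the small jumps and the Gaussian term.
  set G : V → ℂ := fun ξ => (t : ℂ) * (charFun ν₁ ξ - ν₁.real Set.univ) -
    ((t * n⁻¹ * ‖ξ‖ ^ 2 : ℝ) : ℂ) with hG
  have hGc : ContDiff ℝ ∞ G := by
    have h1 := contDiff_charFun_of_ae_norm_le_one hν
    have h2 : ContDiff ℝ ∞ fun ξ : V => ((t * n⁻¹ * ‖ξ‖ ^ 2 : ℝ) : ℂ) :=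
      Complex.ofRealCLM.contDiff.comp (contDiff_const.mul (contDiff_norm_sq ℝ))
    fun_prop
  have hGb := hA₀ ν₁ hν hν₁ (fun ξ hξ => by
    rw [hν₁']
    exact (norm_sub_le _ _).trans (add_le_add ((hΨB ξ).trans (hB ξ hξ)) (hν₂' ξ)))
    n⁻¹ (by positivity) (inv_le_one_of_one_le₀ hn1)
  have hGe : ∀ ξ, G ξ = -t * (Ψ ξ + (n⁻¹ * ‖ξ‖ ^ 2 : ℝ)) +
      t * (ν₂.real Set.univ - charFun ν₂ ξ) := fun ξ => by
    have := hν₁' ξ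
    have h2 : charFun ν₁ ξ - (ν₁.real Set.univ : ℂ) =
      -(Ψ ξ - (ν₂.real Set.univ - charFun ν₂ ξ)) := by rw [← this]; ring
    rw [hG]
    simp only [h2]
    push_cast
    ring
  obtain ⟨hint, hle⟩ := hA G hGc hGb fun M ξ => by
    have h1 := hD M k ξ
    rw [← hn] at h1
    -- `G` differs from the full exponent by the bounded exponent of the big jumps.
    have h2 : ‖Complex.exp (G ξ)‖ ≤
        Real.exp (-(t * ((Ψ ξ).re + n⁻¹ * ‖ξ‖ ^ 2)) + t * (2 * C)) := by
      rw [Complex.norm_exp, hGe]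
      refine Real.exp_le_exp.2 ?_
      have h3 : (-(t : ℂ) * (Ψ ξ + (n⁻¹ * ‖ξ‖ ^ 2 : ℝ)) +
          t * (ν₂.real Set.univ - charFun ν₂ ξ)).re = -(t * ((Ψ ξ).re + n⁻¹ * ‖ξ‖ ^ 2)) +
          t * ((ν₂.real Set.univ : ℂ) - charFun ν₂ ξ).re := by
        rw [Complex.add_re, ← Complex.ofReal_neg, Complex.re_ofReal_mul, Complex.re_ofReal_mul,
          Complex.add_re, Complex.ofReal_re]
        ring
      rw [h3]
      gcongr
      exact (Complex.re_le_norm _).trans (hν₂' ξ)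
    calc _ ≤ Real.exp (-(t * ((Ψ ξ).re + n⁻¹ * ‖ξ‖ ^ 2)) + t * (2 * C)) *
          (D M * Real.exp (t * ((Ψ ξ).re + n⁻¹ * ‖ξ‖ ^ 2))) := by gcongr
      _ = D M * Real.exp (t * (2 * C)) *
          Real.exp (-(t * ((Ψ ξ).re + n⁻¹ * ‖ξ‖ ^ 2)) + t * ((Ψ ξ).re + n⁻¹ * ‖ξ‖ ^ 2)) := by
        rw [Real.exp_add, Real.exp_add]
        ring
      _ = _ := by simp
  -- The big jumps contribute a compound Poisson factor, which does not increase the `L¹` norm.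
  set π := (compoundPoisson (t.toNNReal • ν₂)).map ((2 * Real.pi)⁻¹ • ·) with hπ
  have hπp : IsProbabilityMeasure π := Measure.isProbabilityMeasure_map (by fun_prop)
  have hπc : ∀ ξ, charFun π ((2 * Real.pi) • ξ) =
      Complex.exp (-(t * (ν₂.real Set.univ - charFun ν₂ ξ))) := fun ξ => by
    rw [hπ, charFun_map_smul, smul_smul, inv_mul_cancel₀ Real.two_pi_pos.ne', one_smul,
      charFun_compoundPoisson, charFun_nnreal_smul, measureReal_nnreal_smul_apply]
    congr 1
    rw [Real.coe_toNNReal _ ht.le]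
    push_cast
    ring
  have hfun : (fun ξ => q ξ * Complex.exp (-t * (Ψ ξ + (n⁻¹ * ‖ξ‖ ^ 2 : ℝ)))) =
      fun ξ => q ξ * Complex.exp (G ξ) * charFun π ((2 * Real.pi) • ξ) := by
    ext ξ
    rw [hπc, mul_assoc, ← Complex.exp_add, hGe]
    congr 2
    ring
  change ∫⁻ x, ‖𝓕 (fun ξ => q ξ * Complex.exp (-t * (Ψ ξ + (n⁻¹ * ‖ξ‖ ^ 2 : ℝ)))) x‖ₑ ≤ A
  rw [hfun]
  refine (lintegral_fourier_mul_charFun_le π hint).trans ?_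
  simpa using hle

/-- The main estimate: under the decay assumption, the Fourier transform of `q exp (-t ψ)` is
integrable for every `q` of temperate growth, in particular for the polynomials that represent
derivatives of the density. -/
theorem integrable_fourier_mul_cexp
    (hdec : ∀ t : ℝ, 0 < t → ∀ M : ℕ, ∃ C : ℝ, ∀ ξ, (1 + ‖ξ‖) ^ M ≤ C * Real.exp (t * (ψ ξ).re))
    {q : V → ℂ} (hq : q.HasTemperateGrowth) {t : ℝ} (ht : 0 < t) :
    Integrable (fun ξ => q ξ * Complex.exp (-t * ψ ξ)) ∧
      Integrable (𝓕 fun ξ => q ξ * Complex.exp (-t * ψ ξ)) := by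
  obtain ⟨A, hA⟩ := h.exists_lintegral_fourier_approx_le hdec hq ht
  obtain ⟨m, Cq, hCq0, hCq⟩ := hq.norm_iteratedFDeriv_le_uniform 0
  set N := Module.finrank ℝ V + 1
  have hJ : Integrable (fun ξ : V => ((1 + ‖ξ‖) ^ N)⁻¹) := integrable_inv_one_add_norm_pow V
  have hψc := h.continuous
  have hqc : Continuous q := hq.1.continuous
  -- The same majorant serves for `ψ` and for the approximating exponents.
  have hmaj : ∀ (D : ℝ) (E : ℝ) (ξ : V) (w : ℂ), (1 + ‖ξ‖) ^ (m + N) ≤ D * Real.exp E →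
      w.re = -E → ‖q ξ * Complex.exp w‖ ≤ Cq * D * ((1 + ‖ξ‖) ^ N)⁻¹ := fun D E ξ w h1 h2 => by
    have h3 := hCq 0 le_rfl ξ
    rw [norm_iteratedFDeriv_zero] at h3
    rw [← div_eq_mul_inv, le_div_iff₀ (by positivity), norm_mul, Complex.norm_exp, h2, Real.exp_neg]
    calc _ ≤ Cq * (1 + ‖ξ‖) ^ m * (Real.exp E)⁻¹ * (1 + ‖ξ‖) ^ N := by gcongr
      _ = Cq * ((1 + ‖ξ‖) ^ (m + N) * (Real.exp E)⁻¹) := by ring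
      _ ≤ _ := by
        gcongr
        rwa [← div_eq_mul_inv, div_le_iff₀ (Real.exp_pos _)]
  have hint : Integrable (fun ξ => q ξ * Complex.exp (-t * ψ ξ)) := by
    obtain ⟨C, hC⟩ := hdec t ht (m + N)
    refine (hJ.const_mul (Cq * C)).mono' (by fun_prop) (ae_of_all _ fun ξ => ?_)
    refine hmaj C _ ξ _ (hC ξ) ?_
    rw [← Complex.ofReal_neg, Complex.re_ofReal_mul, neg_mul]
  refine ⟨hint, (continuous_fourier hint).aestronglyMeasurable, ?_⟩
  obtain ⟨D, hD⟩ := h.exists_approx_decay hdec ht (m + N)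
  have hbd : ∀ (k : ℕ) (ξ : V), ‖q ξ * Complex.exp (-t * (((k + 1 : ℝ) ^ 2 : ℂ) *
        (1 - Complex.exp (-(ψ ξ / ((k + 1 : ℝ) ^ 2 : ℂ)))) + ((k + 1 : ℝ)⁻¹ * ‖ξ‖ ^ 2 : ℝ)))‖ ≤
      Cq * D * ((1 + ‖ξ‖) ^ N)⁻¹ := fun k ξ => by
    refine hmaj D _ ξ _ (hD k ξ) ?_
    rw [← Complex.ofReal_neg, Complex.re_ofReal_mul, neg_mul, Complex.add_re, Complex.ofReal_re]
  have hcont : ∀ k : ℕ, Continuous fun ξ => q ξ * Complex.exp (-t * (((k + 1 : ℝ) ^ 2 : ℂ) *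
      (1 - Complex.exp (-(ψ ξ / ((k + 1 : ℝ) ^ 2 : ℂ)))) + ((k + 1 : ℝ)⁻¹ * ‖ξ‖ ^ 2 : ℝ))) := by
    intro k
    fun_prop
  refine lt_of_le_of_lt (lintegral_enorm_le_of_tendsto (fun k => ?_) hA fun x => ?_)
    ENNReal.coe_lt_top
  · refine (continuous_fourier ?_).aestronglyMeasurable
    exact (hJ.const_mul (Cq * D)).mono' (hcont k).aestronglyMeasurable (ae_of_all _ (hbd k))
  · simp only [Real.fourier_eq']
    refine tendsto_integral_of_dominated_convergence
      (fun ξ => Cq * D * ((1 + ‖ξ‖) ^ N)⁻¹) (fun k => ?_) (hJ.const_mul (Cq * D)) (fun k => ?_) ?_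
    · have := hcont k
      exact Continuous.aestronglyMeasurable (by fun_prop)
    · refine ae_of_all _ fun ξ => ?_
      rw [norm_smul, Complex.norm_exp_ofReal_mul_I, one_mul]
      exact hbd k ξ
    · refine ae_of_all _ fun ξ => ?_
      refine Tendsto.const_smul (Tendsto.const_mul _ ?_) _
      refine (Complex.continuous_exp.tendsto _).comp (Tendsto.const_mul _ ?_)
      have h1 := tendsto_mul_one_sub_cexp_neg_div (ψ ξ)
      have h2 : Tendsto (fun k : ℕ => (((k + 1 : ℝ)⁻¹ * ‖ξ‖ ^ 2 : ℝ) : ℂ)) atTop (𝓝 0) := by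
        have h3 : Tendsto (fun k : ℕ => ((k : ℝ) + 1)⁻¹ * ‖ξ‖ ^ 2) atTop (𝓝 0) := by
          have := (tendsto_inv_atTop_zero.comp (tendsto_atTop_add_const_right _ (1 : ℝ)
            (tendsto_natCast_atTop_atTop (R := ℝ)))).mul_const (‖ξ‖ ^ 2)
          simpa using this
        exact_mod_cast (Complex.continuous_ofReal.tendsto 0).comp h3
      simpa using h1.add h2

end HasExponent

end KeyEstimate

/-! ### The Hartman–Wintner condition -/

section HartmanWintner

variable {n : ℕ}

/-- The Hartman–Wintner condition says that `exp (-t Re ψ)` decays faster than any power. -/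
theorem HartmanWintner.exists_pow_le {ψ : EuclideanSpace ℝ (Fin n) → ℂ}
    (hψ : HartmanWintner ψ) (h0 : ∀ ξ, 0 ≤ (ψ ξ).re) {t : ℝ} (ht : 0 < t) (M : ℕ) :
    ∃ C : ℝ, ∀ ξ, (1 + ‖ξ‖) ^ M ≤ C * Real.exp (t * (ψ ξ).re) := by
  have h := tendsto_atTop.1 hψ (M / t)
  obtain ⟨R, -, hR⟩ := (Filter.hasBasis_cobounded_norm.eventually_iff).1 h
  refine ⟨max 1 ((1 + max R 1) ^ M), fun ξ => ?_⟩
  have he : 1 ≤ Real.exp (t * (ψ ξ).re) := Real.one_le_exp (mul_nonneg ht.le (h0 ξ))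
  rcases le_or_gt (max R 1) ‖ξ‖ with hξ | hξ
  · have h1 := hR ((le_max_left _ _).trans hξ)
    have hpos : 0 < ‖ξ‖ := lt_of_lt_of_le one_pos ((le_max_right _ _).trans hξ)
    have hlog : 0 < Real.log (1 + ‖ξ‖) := Real.log_pos (by linarith)
    rw [div_le_div_iff₀ ht hlog] at h1
    calc (1 + ‖ξ‖) ^ M = Real.exp (M * Real.log (1 + ‖ξ‖)) := by
          rw [Real.exp_nat_mul, Real.exp_log (by linarith)]
      _ ≤ 1 * Real.exp (t * (ψ ξ).re) := by
          rw [one_mul]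
          refine Real.exp_le_exp.2 ?_
          linarith
      _ ≤ _ := by
          gcongr
          exact le_max_left _ _
  · calc (1 + ‖ξ‖) ^ M ≤ (1 + max R 1) ^ M * 1 := by
          rw [mul_one]
          gcongr
      _ ≤ _ := by
          gcongr
          exact le_max_right _ _

/-- Decay of `exp (-t Re ψ)` of order one is enough, provided that it holds for all times `t`:
small `t` give large multiples of the logarithm. -/
theorem hartmanWintner_of_norm_le {ψ : EuclideanSpace ℝ (Fin n) → ℂ}
    (h : ∀ t : ℝ≥0, 0 < t → ∃ C : ℝ, ∀ ξ, 1 ≤ ‖ξ‖ → ‖ξ‖ ≤ C * Real.exp (t * (ψ ξ).re)) :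
    HartmanWintner ψ := by
  refine tendsto_atTop.2 fun b => ?_
  set K : ℝ := max b 1
  have hK0 : 0 < K := lt_of_lt_of_le one_pos (le_max_right _ _)
  -- At time `1 / (2 K)`, squaring gives `‖ξ‖ ^ 2 ≤ C ^ 2 exp (Re ψ ξ / K)`; the spare power of
  -- `‖ξ‖` absorbs the constant.
  obtain ⟨C, hC⟩ := h ((2 * K)⁻¹).toNNReal (Real.toNNReal_pos.2 (by positivity))
  rw [Real.coe_toNNReal _ (by positivity)] at hC
  refine (Filter.hasBasis_cobounded_norm.eventually_iff).2
    ⟨max 1 (2 * C ^ 2), trivial, fun ξ hξ => ?_⟩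
  have hξ' : max 1 (2 * C ^ 2) ≤ ‖ξ‖ := hξ
  have h1 : 1 ≤ ‖ξ‖ := (le_max_left _ _).trans hξ'
  have h2 : 2 * C ^ 2 ≤ ‖ξ‖ := (le_max_right _ _).trans hξ'
  have h3 := hC ξ h1
  have hlog : 0 < Real.log (1 + ‖ξ‖) := Real.log_pos (by linarith)
  have h4 : ‖ξ‖ ^ 2 ≤ C ^ 2 * Real.exp ((ψ ξ).re / K) := by
    have e : Real.exp ((ψ ξ).re / K) = Real.exp ((2 * K)⁻¹ * (ψ ξ).re) ^ 2 := by
      rw [← Real.exp_nat_mul]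
      congr 1
      push_cast
      field_simp
    rw [e, ← mul_pow]
    exact pow_le_pow_left₀ (norm_nonneg _) h3 2
  have hC0 : 0 < C ^ 2 := by
    have : C ≠ 0 := fun h0 => by
      rw [h0, zero_mul] at h3
      linarith
    positivity
  have h5 : C ^ 2 * (1 + ‖ξ‖) ≤ ‖ξ‖ ^ 2 := by nlinarith
  have h6 : 1 + ‖ξ‖ ≤ Real.exp ((ψ ξ).re / K) := le_of_mul_le_mul_left (h5.trans h4) hC0
  have h7 : Real.log (1 + ‖ξ‖) ≤ (ψ ξ).re / K := by
    rw [Real.log_le_iff_le_exp (by linarith)]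
    exact h6
  rw [le_div_iff₀ hK0] at h7
  rw [le_div_iff₀ hlog]
  calc b * Real.log (1 + ‖ξ‖) ≤ K * Real.log (1 + ‖ξ‖) := by
        gcongr
        exact le_max_left _ _
    _ ≤ _ := by linarith

end HartmanWintner

/-! ### Derivatives of Fourier transforms -/

section SmoothDensity

open scoped RealInnerProductSpace ContDiff FourierTransform

variable {V : Type*} [NormedAddCommGroup V] [InnerProductSpace ℝ V] [FiniteDimensional ℝ V]
  [MeasurableSpace V] [BorelSpace V]

omit [FiniteDimensional ℝ V] in
/-- Scaling the laws scales the exponent. With `r = 2 π` this accounts for the normalisation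
of `𝓕`. -/
theorem HasExponent.map_smul {μ : ℝ≥0 → Measure V} {ψ : V → ℂ} (h : HasExponent μ ψ) (r : ℝ) :
    HasExponent (fun t => (μ t).map (r • ·)) (fun ξ => ψ (r • ξ)) where
  prob t := by
    have := h.prob t
    exact Measure.isProbabilityMeasure_map (by fun_prop)
  charFun_eq t ξ := by rw [charFun_map_smul, h.charFun_eq]

/-- The Riemann–Lebesgue lemma. It holds for every `f`, as `𝓕 f = 0` if `f` is not integrable. -/
theorem tendsto_fourier_cobounded (f : V → ℂ) :
    Tendsto (𝓕 f) (Bornology.cobounded V) (𝓝 0) := by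
  rw [Metric.cobounded_eq_cocompact]
  exact tendsto_integral_exp_inner_smul_cocompact f

omit [FiniteDimensional ℝ V] [MeasurableSpace V] [BorelSpace V] in
theorem hasTemperateGrowth_prod_inner {ι : Type*} (s : Finset ι) (a : ι → V) :
    (fun ξ : V => ∏ i ∈ s, ((⟪ξ, a i⟫ : ℝ) : ℂ)).HasTemperateGrowth := by
  classical
  induction s using Finset.induction_on with
  | empty => simp
  | insert i s hi ih =>
    simp_rw [Finset.prod_insert hi]
    fun_prop

theorem iteratedFDeriv_re_fourier_apply {f : V → ℂ}
    (hf : ∀ k : ℕ, Integrable fun ξ => ‖ξ‖ ^ k * ‖f ξ‖) (hfm : AEStronglyMeasurable f)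
    {k : ℕ} (m : Fin k → V) (x : V) :
    iteratedFDeriv ℝ k (fun x => (𝓕 f x).re) x m =
      (𝓕 (fun ξ => (-(2 * Real.pi * Complex.I)) ^ k * (∏ i, ((⟪ξ, m i⟫ : ℝ) : ℂ)) * f ξ) x).re := by
  have hc : ContDiff ℝ ∞ (𝓕 f) := Real.contDiff_fourier fun k _ => hf k
  have h1 := Complex.reCLM.iteratedFDeriv_comp_left (hc.contDiffAt (x := x)) (i := k)
    (by exact_mod_cast le_top)
  have e : (fun x => (𝓕 f x).re) = Complex.reCLM ∘ 𝓕 f := rfl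
  rw [e, h1, ContinuousLinearMap.compContinuousMultilinearMap_coe, Function.comp_apply,
    Complex.reCLM_apply, Real.iteratedFDeriv_fourier (N := ⊤) (fun k _ => hf k) hfm le_top,
    Real.fourier_continuousMultilinearMap_apply
      (VectorFourier.integrable_fourierPowSMulRight _ (hf k) hfm)]
  have e2 : (fun ξ => VectorFourier.fourierPowSMulRight (innerSL ℝ) f ξ k m) = fun ξ =>
      (-(2 * Real.pi * Complex.I)) ^ k * (∏ i, ((⟪ξ, m i⟫ : ℝ) : ℂ)) * f ξ := by
    funext ξ
    rw [VectorFourier.fourierPowSMulRight_apply]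
    simp [innerSL_apply_apply ℝ, smul_eq_mul, mul_assoc]
  rw [e2]

end SmoothDensity

/-! ### The implications between the conditions -/

section Implications

open scoped RealInnerProductSpace ContDiff FourierTransform

variable {n : ℕ} {Ω : Type*} [MeasurableSpace Ω] {P : Measure Ω} [IsProbabilityMeasure P]
  {X : ℝ≥0 → Ω → EuclideanSpace ℝ (Fin n)} {ψ : EuclideanSpace ℝ (Fin n) → ℂ}

theorem IsCharExponent.hasExponent (hX : ∀ t, Measurable (X t)) (hψ : IsCharExponent P X ψ) :
    HasExponent (fun t => P.map (X t)) ψ where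
  prob t := Measure.isProbabilityMeasure_map (hX t).aemeasurable
  charFun_eq := hψ

theorem HartmanWintner.hasSmoothDensities (hX : ∀ t, Measurable (X t))
    (hψ : IsCharExponent P X ψ) (hHW : HartmanWintner ψ) : HasSmoothDensities P X := by
  intro t ht
  have h := hψ.hasExponent hX
  have h' := h.map_smul (2 * Real.pi)
  have hpi : 1 ≤ 2 * Real.pi := by linarith [Real.pi_gt_three]
  have hdec : ∀ t : ℝ, 0 < t → ∀ M : ℕ, ∃ C : ℝ, ∀ ξ : EuclideanSpace ℝ (Fin n),
      (1 + ‖ξ‖) ^ M ≤ C * Real.exp (t * (ψ ((2 * Real.pi) • ξ)).re) := fun t ht M => by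
    obtain ⟨C, hC⟩ := hHW.exists_pow_le h.re_nonneg ht M
    refine ⟨C, fun ξ => le_trans ?_ (hC _)⟩
    gcongr
    rw [norm_smul, Real.norm_of_nonneg (by positivity)]
    exact le_mul_of_one_le_left (norm_nonneg _) hpi
  set μ := P.map (X t) with hμ
  set φ : EuclideanSpace ℝ (Fin n) → ℂ := fun ξ => charFun μ ((2 * Real.pi) • ξ)
  have hφe : φ = fun ξ => Complex.exp (-((t : ℝ) : ℂ) * ψ ((2 * Real.pi) • ξ)) := by
    ext ξ
    exact h.charFun_eq t _
  have hφc : Continuous φ := by fun_prop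
  have key : ∀ q : EuclideanSpace ℝ (Fin n) → ℂ, q.HasTemperateGrowth →
      Integrable (fun ξ => q ξ * φ ξ) ∧ Integrable (𝓕 fun ξ => q ξ * φ ξ) := fun q hq => by
    rw [hφe]
    exact h'.integrable_fourier_mul_cexp hdec hq ht
  have hφi : Integrable φ := by
    simpa using (key (fun _ => 1) (Function.HasTemperateGrowth.const 1)).1
  have hmom : ∀ k : ℕ, Integrable fun ξ => ‖ξ‖ ^ k * ‖φ ξ‖ := fun k => by
    refine (key (fun ξ => ((1 + ‖ξ‖ ^ 2 : ℝ) : ℂ) ^ k) (by fun_prop)).1.mono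
      (Continuous.aestronglyMeasurable (by fun_prop)) (ae_of_all _ fun ξ => ?_)
    rw [norm_mul, norm_norm, norm_pow, norm_norm, norm_mul, norm_pow, Complex.norm_real,
      Real.norm_of_nonneg (by positivity)]
    gcongr
    nlinarith [sq_nonneg (‖ξ‖ - 1), norm_nonneg ξ]
  refine ⟨fun x => (𝓕 φ x).re, ⟨?_, fun x => (fourier_charFun_nonneg μ hφi x).1,
    eq_withDensity_fourier_charFun μ hφi⟩, ?_, fun k m => ?_⟩
  · exact (Complex.continuous_re.comp (continuous_fourier hφi)).measurable
  · exact Complex.reCLM.contDiff.comp (Real.contDiff_fourier (N := ⊤) fun k _ => hmom k)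
  · set q : EuclideanSpace ℝ (Fin n) → ℂ := fun ξ => (-(2 * Real.pi * Complex.I)) ^ k *
      (∏ i, ((⟪ξ, EuclideanSpace.single (m i) (1 : ℝ)⟫ : ℝ) : ℂ)) with hq
    have hqt : q.HasTemperateGrowth :=
      (Function.HasTemperateGrowth.const _).mul (hasTemperateGrowth_prod_inner _ _)
    have e : partialDerivative m (fun x => (𝓕 φ x).re) =
        fun x => (𝓕 (fun ξ => q ξ * φ ξ) x).re := by
      ext x
      exact iteratedFDeriv_re_fourier_apply hmom hφc.aestronglyMeasurable _ x
    rw [e]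
    refine ⟨(key q hqt).2.re, Complex.continuous_re.comp (continuous_fourier (key q hqt).1), ?_⟩
    exact (Complex.continuous_re.tendsto' 0 0 Complex.zero_re).comp (tendsto_fourier_cobounded _)

theorem partialDerivative_zero (m : Fin 0 → Fin n) (f : EuclideanSpace ℝ (Fin n) → ℝ) :
    partialDerivative m f = f := by
  ext x
  simp [partialDerivative]

omit [IsProbabilityMeasure P] in
theorem HasSmoothDensities.hasSobolevDensities (h : HasSmoothDensities P X) :
    HasSobolevDensities P X := by
  intro t ht
  obtain ⟨p, hp, hpc, hpd⟩ := h t ht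
  have e1 : ∀ i, partialDerivative (fun _ : Fin 1 => i) p =
      fun x => fderiv ℝ p x (EuclideanSpace.single i 1) := fun i => by
    ext x
    simp [partialDerivative]
  have hpi : Integrable p := by
    have := (hpd 0 fun i => i.elim0).1
    rwa [partialDerivative_zero] at this
  have hpi' : ∀ i, Integrable fun x => fderiv ℝ p x (EuclideanSpace.single i 1) := fun i => by
    have := (hpd 1 fun _ => i).1
    rwa [e1] at this
  have hv : Integrable fun x => WithLp.toLp 2 fun i : Fin n =>
      fderiv ℝ p x (EuclideanSpace.single i 1) := Integrable.of_eval_piLp hpi'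
  refine ⟨p, hp, hpi, _, ⟨hpi.locallyIntegrable, hv.locallyIntegrable, fun φ hφ hφs i => ?_⟩, hv⟩
  have hpf : Continuous (fderiv ℝ p) := hpc.continuous_fderiv (by simp)
  have hφc := hφ.continuous
  have hpc' := hpc.continuous
  refine integral_mul_fderiv_eq_neg_fderiv_mul_of_integrable ?_ ?_ ?_
    (fun x _ => hpc.differentiable (by simp) x) (fun x _ => hφ.differentiable (by simp) x)
  · exact Continuous.integrable_of_hasCompactSupport (by fun_prop) hφs.mul_left
  · refine Continuous.integrable_of_hasCompactSupport (by fun_prop) ?_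
    exact (hφs.fderiv_apply ℝ _).mul_left
  · exact Continuous.integrable_of_hasCompactSupport (by fun_prop) hφs.mul_left

/-- A weak gradient may be tested against bounded smooth functions with bounded derivative, if the
function and its gradient are integrable. -/
theorem IsWeakGradient.integral_eq_of_bounded {p : EuclideanSpace ℝ (Fin n) → ℝ}
    {v : EuclideanSpace ℝ (Fin n) → EuclideanSpace ℝ (Fin n)} (h : IsWeakGradient p v)
    (hp : Integrable p) (hv : Integrable v) {f : EuclideanSpace ℝ (Fin n) → ℝ}
    (hf : ContDiff ℝ ∞ f) {A B : ℝ} (hA : ∀ x, ‖f x‖ ≤ A) (hB : ∀ x, ‖fderiv ℝ f x‖ ≤ B)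
    (i : Fin n) :
    ∫ x, p x * fderiv ℝ f x (EuclideanSpace.single i 1) = -∫ x, v x i * f x := by
  -- Multiply `f` by the cutoff functions `χ (x / (k + 1))`.
  let χ : ContDiffBump (0 : EuclideanSpace ℝ (Fin n)) := ⟨1, 2, one_pos, one_lt_two⟩
  have hχc : ContDiff ℝ ∞ χ := χ.contDiff
  obtain ⟨D, hD⟩ := (χ.hasCompactSupport.fderiv ℝ).exists_bound_of_continuous
    (hχc.continuous_fderiv (by simp))
  set c : ℕ → ℝ := fun k => (k + 1 : ℝ)⁻¹
  have hc0 : ∀ k, c k ≠ 0 := fun k => by positivity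
  have hc1 : ∀ k, ‖c k‖ ≤ 1 := fun k => by
    rw [Real.norm_of_nonneg (by positivity)]
    exact inv_le_one_of_one_le₀ (by simp)
  have hclim : Tendsto c atTop (𝓝 0) :=
    tendsto_inv_atTop_zero.comp
      (tendsto_atTop_add_const_right _ (1 : ℝ) tendsto_natCast_atTop_atTop)
  have hχs : ∀ k, ContDiff ℝ ∞ fun x => χ (c k • x) := fun k => hχc.comp (contDiff_const_smul _)
  have hχ1 : ∀ y, ‖χ y‖ ≤ 1 := fun y => by
    rw [Real.norm_of_nonneg χ.nonneg]
    exact χ.le_one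
  have hχlim : ∀ x, Tendsto (fun k => χ (c k • x)) atTop (𝓝 1) := fun x => by
    have h1 : Tendsto (fun k => χ (c k • x)) atTop (𝓝 (χ ((0 : ℝ) • x))) :=
      (χ.continuous.tendsto _).comp (hclim.smul_const x)
    rwa [zero_smul, χ.one_of_mem_closedBall (by simp [χ])] at h1
  have hfd : ∀ k x, fderiv ℝ (fun x => χ (c k • x) * f x) x (EuclideanSpace.single i 1) =
      χ (c k • x) * fderiv ℝ f x (EuclideanSpace.single i 1) +
        f x * (c k * fderiv ℝ χ (c k • x) (EuclideanSpace.single i 1)) := fun k x => by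
    have h1 : HasFDerivAt (fun x => χ (c k • x)) (c k • fderiv ℝ χ (c k • x)) x := by
      have h2 := (hχc.differentiable (by simp) (c k • x)).hasFDerivAt.comp x
        ((hasFDerivAt_id x).const_smul (c k))
      refine h2.congr_fderiv ?_
      ext y
      simp
    have h3 := h1.fun_mul (hf.differentiable (by simp) x).hasFDerivAt
    rw [h3.fderiv]
    simp
  have hE : ∀ k, ∫ x, p x * (χ (c k • x) * fderiv ℝ f x (EuclideanSpace.single i 1) +
        f x * (c k * fderiv ℝ χ (c k • x) (EuclideanSpace.single i 1))) =
      -∫ x, v x i * (χ (c k • x) * f x) := fun k => by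
    simp_rw [← hfd]
    refine h.integral_eq _ ((hχs k).mul hf) ?_ i
    exact (χ.hasCompactSupport.comp_smul (hc0 k)).mul_right
  have hfc := hf.continuous
  have hA0 : 0 ≤ A := (norm_nonneg _).trans (hA 0)
  have hsingle : ‖(EuclideanSpace.single i (1 : ℝ) : EuclideanSpace ℝ (Fin n))‖ = 1 := by simp
  have hap : ∀ (L : EuclideanSpace ℝ (Fin n) →L[ℝ] ℝ) {M : ℝ}, ‖L‖ ≤ M →
      ‖L (EuclideanSpace.single i 1)‖ ≤ M := fun L M hL => by
    refine (L.le_opNorm _).trans ?_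
    rwa [hsingle, mul_one]
  have hL : Tendsto (fun k => ∫ x, p x * (χ (c k • x) * fderiv ℝ f x (EuclideanSpace.single i 1) +
        f x * (c k * fderiv ℝ χ (c k • x) (EuclideanSpace.single i 1)))) atTop
      (𝓝 (∫ x, p x * fderiv ℝ f x (EuclideanSpace.single i 1))) := by
    refine tendsto_integral_of_dominated_convergence (fun x => ‖p x‖ * (1 * B + A * (1 * D)))
      (fun k => ?_) (hp.norm.mul_const _) (fun k => ae_of_all _ fun x => ?_)
      (ae_of_all _ fun x => ?_)
    · exact hp.1.mul (Continuous.aestronglyMeasurable (by fun_prop))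
    · rw [norm_mul]
      refine mul_le_mul_of_nonneg_left ((norm_add_le _ _).trans ?_) (norm_nonneg _)
      rw [norm_mul, norm_mul, norm_mul]
      have h1 := hap _ (hB x)
      have h2 := hap _ (hD (c k • x))
      have h3 := hχ1 (c k • x)
      have h4 := hA x
      have h5 := hc1 k
      gcongr
    · have hb : Tendsto (fun k => c k * fderiv ℝ χ (c k • x) (EuclideanSpace.single i 1)) atTop
          (𝓝 0) := by
        refine squeeze_zero_norm (fun k => ?_) (by simpa using hclim.norm.mul_const D)
        rw [norm_mul]
        exact mul_le_mul_of_nonneg_left (hap _ (hD _)) (norm_nonneg _)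
      simpa using (((hχlim x).mul_const (fderiv ℝ f x (EuclideanSpace.single i 1))).add
        (hb.const_mul (f x))).const_mul (p x)
  have hR : Tendsto (fun k => -∫ x, v x i * (χ (c k • x) * f x)) atTop
      (𝓝 (-∫ x, v x i * f x)) := by
    refine (tendsto_integral_of_dominated_convergence (fun x => ‖v x i‖ * (1 * A))
      (fun k => ?_) ((hv.eval_piLp i).norm.mul_const _) (fun k => ae_of_all _ fun x => ?_)
      (ae_of_all _ fun x => ?_)).neg
    · exact (hv.eval_piLp i).1.mul (Continuous.aestronglyMeasurable (by fun_prop))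
    · rw [norm_mul, norm_mul]
      have h3 := hχ1 (c k • x)
      have h4 := hA x
      gcongr
    · simpa using ((hχlim x).mul_const (f x)).const_mul (v x i)
  exact tendsto_nhds_unique hL (hR.congr fun k => (hE k).symm)

/-- Testing the gradient against `f ⟪x, ξ⟫` bounds `ξ i * ∫ p f' ⟪x, ξ⟫`. With sines and cosines for
`f` this controls the characteristic function of a law with density `p`. -/
theorem IsWeakGradient.abs_mul_integral_le {p : EuclideanSpace ℝ (Fin n) → ℝ}
    {v : EuclideanSpace ℝ (Fin n) → EuclideanSpace ℝ (Fin n)} (h : IsWeakGradient p v)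
    (hp : Integrable p) (hv : Integrable v) (ξ : EuclideanSpace ℝ (Fin n)) (i : Fin n)
    {f f' : ℝ → ℝ}
    (hf : ContDiff ℝ ∞ f) (hf' : ∀ y, HasDerivAt f (f' y) y) (hf1 : ∀ y, |f y| ≤ 1)
    (hf1' : ∀ y, |f' y| ≤ 1) :
    |ξ i| * |∫ x, p x * f' ⟪x, ξ⟫| ≤ ∫ x, ‖v x‖ := by
  have hd : ∀ x, HasFDerivAt (fun x => f ⟪x, ξ⟫) (f' ⟪x, ξ⟫ • innerSL ℝ ξ) x := fun x => by
    have h1 : HasFDerivAt (fun x => ⟪x, ξ⟫) (innerSL ℝ ξ) x := by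
      simp_rw [real_inner_comm]
      exact (innerSL ℝ ξ).hasFDerivAt
    exact (hf' _).comp_hasFDerivAt x h1
  have hi := h.integral_eq_of_bounded hp hv (f := fun x => f ⟪x, ξ⟫) (A := 1) (B := ‖ξ‖)
    (hf.comp (contDiff_id.inner ℝ contDiff_const)) (fun x => hf1 _) (fun x => ?_) i
  · have e : ∀ x, p x * fderiv ℝ (fun x => f ⟪x, ξ⟫) x (EuclideanSpace.single i 1) =
        ξ i * (p x * f' ⟪x, ξ⟫) := fun x => by
      rw [(hd x).fderiv]
      simp [innerSL_apply_apply ℝ, EuclideanSpace.inner_single_right]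
      ring
    simp_rw [e] at hi
    rw [integral_const_mul] at hi
    rw [← abs_mul, hi, abs_neg, ← Real.norm_eq_abs]
    refine norm_integral_le_of_norm_le hv.norm (ae_of_all _ fun x => ?_)
    rw [norm_mul]
    calc _ ≤ ‖v x‖ * 1 :=
          mul_le_mul (PiLp.norm_apply_le _ i) (hf1 _) (abs_nonneg _) (norm_nonneg _)
      _ = _ := mul_one _
  · rw [(hd x).fderiv, norm_smul, innerSL_apply_norm]
    exact mul_le_of_le_one_left (norm_nonneg _) (hf1' _)

omit [IsProbabilityMeasure P] in
theorem IsDensityOf.charFun_eq {Y : Ω → EuclideanSpace ℝ (Fin n)}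
    {p : EuclideanSpace ℝ (Fin n) → ℝ} (h : IsDensityOf P Y p) (hp : Integrable p)
    (ξ : EuclideanSpace ℝ (Fin n)) :
    charFun (P.map Y) ξ = ((∫ x, p x * Real.cos ⟪x, ξ⟫ : ℝ) : ℂ) +
      ((∫ x, p x * Real.sin ⟪x, ξ⟫ : ℝ) : ℂ) * Complex.I := by
  have hc : Integrable fun x => p x * Real.cos ⟪x, ξ⟫ :=
    hp.mul_bdd (c := 1) (by fun_prop) (ae_of_all _ fun x => Real.abs_cos_le_one _)
  have hs : Integrable fun x => p x * Real.sin ⟪x, ξ⟫ :=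
    hp.mul_bdd (c := 1) (by fun_prop) (ae_of_all _ fun x => Real.abs_sin_le_one _)
  rw [h.map_eq, charFun_apply, integral_withDensity_eq_integral_toReal_smul
    h.measurable.ennreal_ofReal (ae_of_all _ fun x => ENNReal.ofReal_lt_top),
    ← integral_complex_ofReal, ← integral_complex_ofReal, ← integral_mul_const,
    ← integral_add hc.ofReal (hs.ofReal.mul_const _)]
  refine integral_congr_ae (ae_of_all _ fun x => ?_)
  simp only
  rw [ENNReal.toReal_ofReal (h.nonneg x), Complex.real_smul, Complex.exp_mul_I]
  push_cast
  ring

omit [IsProbabilityMeasure P] in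
theorem HasSobolevDensities.hartmanWintner (hψ : IsCharExponent P X ψ)
    (h : HasSobolevDensities P X) : HartmanWintner ψ := by
  refine hartmanWintner_of_norm_le fun t ht => ?_
  obtain ⟨p, hpd, hp, v, hpv, hv⟩ := h t ht
  refine ⟨n * (2 * ∫ x, ‖v x‖), fun ξ _ => ?_⟩
  -- Sine and cosine control the real and the imaginary part of the characteristic function.
  have hcoord : ∀ i, |ξ i| ≤ (2 * ∫ x, ‖v x‖) * Real.exp (t * (ψ ξ).re) := fun i => by
    have h1 := hpv.abs_mul_integral_le hp hv ξ i (f := Real.sin) (f' := Real.cos)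
      Real.contDiff_sin Real.hasDerivAt_sin Real.abs_sin_le_one Real.abs_cos_le_one
    have h2 := hpv.abs_mul_integral_le hp hv ξ i (f := fun y => -Real.cos y) (f' := Real.sin)
      Real.contDiff_cos.neg (fun y => by simpa using (Real.hasDerivAt_cos y).fun_neg)
      (fun y => by rw [abs_neg]; exact Real.abs_cos_le_one y) Real.abs_sin_le_one
    have h3 : ‖charFun (P.map (X t)) ξ‖ ≤ |∫ x, p x * Real.cos ⟪x, ξ⟫| +
        |∫ x, p x * Real.sin ⟪x, ξ⟫| := by
      rw [hpd.charFun_eq hp]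
      refine (norm_add_le _ _).trans ?_
      rw [norm_mul, Complex.norm_I, mul_one, Complex.norm_real, Complex.norm_real]
      rfl
    rw [hψ, Complex.norm_exp, ← Complex.ofReal_neg, Complex.re_ofReal_mul, neg_mul,
      Real.exp_neg] at h3
    have h4 : |ξ i| * (Real.exp (t * (ψ ξ).re))⁻¹ ≤ 2 * ∫ x, ‖v x‖ := by
      calc _ ≤ |ξ i| * (|∫ x, p x * Real.cos ⟪x, ξ⟫| + |∫ x, p x * Real.sin ⟪x, ξ⟫|) := by gcongr
        _ ≤ _ := by rw [mul_add]; linarith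
    rwa [← div_eq_mul_inv, div_le_iff₀ (Real.exp_pos _)] at h4
  have hsum : ‖ξ‖ ≤ ∑ i, |ξ i| := by
    have := EuclideanSpace.norm_eq ξ
    rw [this]
    refine Real.sqrt_le_iff.2 ⟨Finset.sum_nonneg fun i _ => abs_nonneg _, ?_⟩
    exact Finset.sum_sq_le_sq_sum_of_nonneg fun i _ => abs_nonneg _
  calc ‖ξ‖ ≤ ∑ i, |ξ i| := hsum
    _ ≤ ∑ _i : Fin n, (2 * ∫ x, ‖v x‖) * Real.exp (t * (ψ ξ).re) :=
        Finset.sum_le_sum fun i _ => hcoord i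
    _ = _ := by simp; ring

omit [IsProbabilityMeasure P] in
theorem HasSmoothDensities.hasCInftyDensities (h : HasSmoothDensities P X) :
    HasCInftyDensities P X := by
  intro t ht
  obtain ⟨p, hp, hpc, hpd⟩ := h t ht
  have := (hpd 0 fun i => i.elim0).2
  rw [partialDerivative_zero] at this
  exact ⟨p, hp, this⟩

omit [IsProbabilityMeasure P] in
theorem HasCInftyDensities.hasBoundedDensities (h : HasCInftyDensities P X) :
    HasBoundedDensities P X := by
  intro t ht
  obtain ⟨p, hp, hpc, hp0⟩ := h t ht
  rw [Metric.cobounded_eq_cocompact] at hp0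
  let q : ZeroAtInftyContinuousMap (EuclideanSpace ℝ (Fin n)) ℝ := ⟨⟨p, hpc⟩, hp0⟩
  exact ⟨p, hp, memLp_top_of_bound hpc.aestronglyMeasurable ‖q.toBCF‖
    (ae_of_all _ fun x => q.toBCF.norm_coe_le_norm x)⟩

omit [IsProbabilityMeasure P] in
/-- The Gaussian regularisations of a law with bounded density are bounded by the essential supremum
of the density. -/
theorem IsDensityOf.enorm_integral_heatKernel_le {Y : Ω → EuclideanSpace ℝ (Fin n)}
    {p : EuclideanSpace ℝ (Fin n) → ℝ} (h : IsDensityOf P Y p) {b : ℝ} (hb : 0 < b)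
    (x : EuclideanSpace ℝ (Fin n)) :
    ‖∫ y, heatKernel (EuclideanSpace ℝ (Fin n)) b (x - y) ∂(P.map Y)‖ₑ ≤ eLpNorm p ∞ volume := by
  have hm : Measurable fun y => ‖heatKernel (EuclideanSpace ℝ (Fin n)) b (x - y)‖ₑ := by
    unfold heatKernel
    fun_prop
  have he : ∀ y, ‖heatKernel (EuclideanSpace ℝ (Fin n)) b y‖ₑ =
      ENNReal.ofReal (heatKernel (EuclideanSpace ℝ (Fin n)) b y) := fun y => by
    rw [← ofReal_norm, Real.norm_of_nonneg (heatKernel_nonneg hb y)]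
  refine (enorm_integral_le_lintegral_enorm _).trans ?_
  rw [h.map_eq, lintegral_withDensity_eq_lintegral_mul _ h.measurable.ennreal_ofReal hm]
  calc _ ≤ ∫⁻ y, eLpNorm p ∞ volume * ‖heatKernel (EuclideanSpace ℝ (Fin n)) b (x - y)‖ₑ := by
        refine lintegral_mono_ae ?_
        filter_upwards [enorm_ae_le_eLpNormEssSup p volume] with y hy
        rw [Pi.mul_apply, eLpNorm_exponent_top]
        gcongr
        rwa [← ofReal_norm, Real.norm_of_nonneg (h.nonneg y)] at hy
    _ = eLpNorm p ∞ volume := by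
        rw [lintegral_const_mul _ hm,
          lintegral_sub_left_eq_self (fun y => ‖heatKernel (EuclideanSpace ℝ (Fin n)) b y‖ₑ) x]
        simp_rw [he]
        rw [lintegral_heatKernel hb, mul_one]

theorem HasBoundedDensities.hasIntegrableExp (hX : ∀ t, Measurable (X t))
    (hψ : IsCharExponent P X ψ) (hre : ∀ ξ, (ψ ξ).im = 0) (h : HasBoundedDensities P X) :
    HasIntegrableExp ψ := by
  intro t ht
  obtain ⟨p, hp, hpb⟩ := h t ht
  set μ := P.map (X t)
  have : IsProbabilityMeasure μ := Measure.isProbabilityMeasure_map (hX t).aemeasurable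
  have hφe : (fun ξ => Complex.exp (-((t : ℝ) : ℂ) * ψ ξ)) = charFun μ := by
    ext ξ
    exact (hψ t ξ).symm
  rw [hφe, ← integrable_comp_smul_iff volume _ Real.two_pi_pos.ne']
  have hpos : ∀ ξ, charFun μ ξ = ((Real.exp (-(t * (ψ ξ).re)) : ℝ) : ℂ) := fun ξ => by
    rw [hψ t ξ]
    have : ψ ξ = ((ψ ξ).re : ℂ) := Complex.ext rfl (by simp [hre ξ])
    rw [this]
    push_cast
    simp
  have hk : ∀ k : ℕ, (0 : ℝ) < (k + 1 : ℝ)⁻¹ := fun k => by positivity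
  refine ⟨Continuous.aestronglyMeasurable (by fun_prop), ?_⟩
  refine lt_of_le_of_lt (lintegral_enorm_le_of_tendsto (C := eLpNorm p ∞ volume)
    (F := fun (k : ℕ) ξ => Complex.exp (-((k + 1 : ℝ)⁻¹ : ℝ) * ‖ξ‖ ^ 2) *
      charFun μ ((2 * Real.pi) • ξ)) (fun k => Continuous.aestronglyMeasurable (by fun_prop))
    (fun k => ?_) (fun ξ => ?_)) hpb.2
  · have hint : Integrable fun ξ : EuclideanSpace ℝ (Fin n) =>
        Complex.exp (-((k + 1 : ℝ)⁻¹ : ℝ) * ‖ξ‖ ^ 2) * charFun μ ((2 * Real.pi) • ξ) :=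
      (integrable_cexp_neg_mul_norm_sq (hk k)).mul_bdd (c := 1) (by fun_prop)
        (ae_of_all _ fun ξ => norm_charFun_le_one _)
    have hval : ∀ ξ : EuclideanSpace ℝ (Fin n),
        Complex.exp (-((k + 1 : ℝ)⁻¹ : ℝ) * ‖ξ‖ ^ 2) * charFun μ ((2 * Real.pi) • ξ) =
        ((‖Complex.exp (-((k + 1 : ℝ)⁻¹ : ℝ) * ‖ξ‖ ^ 2) * charFun μ ((2 * Real.pi) • ξ)‖ : ℝ) :
          ℂ) := fun ξ => by
      have e : Complex.exp (-((k + 1 : ℝ)⁻¹ : ℝ) * ‖ξ‖ ^ 2) * charFun μ ((2 * Real.pi) • ξ) =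
          ((Real.exp (-(k + 1 : ℝ)⁻¹ * ‖ξ‖ ^ 2) *
            Real.exp (-(t * (ψ ((2 * Real.pi) • ξ)).re)) : ℝ) : ℂ) := by
        rw [hpos]
        push_cast
        rfl
      rw [e, Complex.norm_real, Real.norm_of_nonneg (by positivity)]
    -- The integrand is positive, so that its `L¹` norm is the Fourier transform at the origin.
    have h0 := fourier_gaussian_mul_charFun μ (hk k) 0
    rw [Real.fourier_eq'] at h0
    simp only [inner_zero_right, mul_zero, Complex.ofReal_zero, zero_mul, Complex.exp_zero,
      one_smul] at h0
    rw [integral_congr_ae (ae_of_all _ hval), integral_complex_ofReal, Complex.ofReal_inj] at h0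
    rw [← ofReal_integral_norm_eq_lintegral_enorm hint, h0]
    exact (Real.ofReal_le_enorm _).trans (hp.enorm_integral_heatKernel_le (hk k) 0)
  · have h1 : Tendsto (fun k : ℕ => -(((k + 1 : ℝ)⁻¹ : ℝ) : ℂ) * (‖ξ‖ : ℂ) ^ 2) atTop (𝓝 0) := by
      have h2 := (Complex.continuous_ofReal.tendsto 0).comp (tendsto_inv_atTop_zero.comp
        (tendsto_atTop_add_const_right _ (1 : ℝ) (tendsto_natCast_atTop_atTop (R := ℝ))))
      simpa [Function.comp_def] using h2.neg.mul_const ((‖ξ‖ : ℂ) ^ 2)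
    simpa using ((Complex.continuous_exp.tendsto 0).comp h1).mul_const
      (charFun μ ((2 * Real.pi) • ξ))

theorem HasIntegrableExp.hartmanWintner (hn : 1 ≤ n) {g : ℝ → ℝ} (hg : MonotoneOn g (Set.Ici 0))
    (hψ : ∀ ξ, ψ ξ = ((g (‖ξ‖ ^ 2) : ℝ) : ℂ)) (h : HasIntegrableExp ψ) : HartmanWintner ψ := by
  have : Nonempty (Fin n) := ⟨⟨0, hn⟩⟩
  refine hartmanWintner_of_norm_le fun t ht => ?_
  have hI := (h t ht).norm
  set I := ∫ ξ, ‖Complex.exp (-((t : ℝ) : ℂ) * ψ ξ)‖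
  have hnorm : ∀ ξ, ‖Complex.exp (-((t : ℝ) : ℂ) * ψ ξ)‖ = Real.exp (-(t * g (‖ξ‖ ^ 2))) :=
    fun ξ => by
      rw [Complex.norm_exp, hψ, ← Complex.ofReal_neg, Complex.re_ofReal_mul, Complex.ofReal_re,
        neg_mul]
  set c := volume.real (Metric.ball (0 : EuclideanSpace ℝ (Fin n)) 1) with hc
  have hc0 : 0 < c := ENNReal.toReal_pos (Metric.measure_ball_pos _ _ one_pos).ne'
    measure_ball_lt_top.ne
  refine ⟨I / c, fun ξ hξ => ?_⟩
  have hvol : volume.real (Metric.ball (0 : EuclideanSpace ℝ (Fin n)) ‖ξ‖) = ‖ξ‖ ^ n * c := by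
    rw [hc, measureReal_def, Measure.addHaar_ball _ _ (norm_nonneg _), ENNReal.toReal_mul,
      ENNReal.toReal_ofReal (by positivity), finrank_euclideanSpace_fin, measureReal_def]
  have h1 : ‖ξ‖ ^ n * c * Real.exp (-(t * g (‖ξ‖ ^ 2))) ≤ I := by
    calc _ = ∫ _η in Metric.ball (0 : EuclideanSpace ℝ (Fin n)) ‖ξ‖,
          Real.exp (-(t * g (‖ξ‖ ^ 2))) := by
          rw [setIntegral_const, hvol, smul_eq_mul]
      _ ≤ ∫ η in Metric.ball (0 : EuclideanSpace ℝ (Fin n)) ‖ξ‖,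
          ‖Complex.exp (-((t : ℝ) : ℂ) * ψ η)‖ := by
          refine setIntegral_mono_on (integrableOn_const measure_ball_lt_top.ne)
            hI.integrableOn measurableSet_ball fun η hη => ?_
          have hη' : ‖η‖ < ‖ξ‖ := by simpa using hη
          rw [hnorm]
          gcongr
          exact hg (Set.mem_Ici.2 (sq_nonneg _)) (Set.mem_Ici.2 (sq_nonneg _)) (by gcongr)
      _ ≤ I := setIntegral_le_integral hI (ae_of_all _ fun _ => norm_nonneg _)
  rw [hψ, Complex.ofReal_re]
  have h2 : ‖ξ‖ ≤ ‖ξ‖ ^ n := le_self_pow₀ hξ (by omega)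
  rw [Real.exp_neg, ← div_eq_mul_inv, div_le_iff₀ (Real.exp_pos _)] at h1
  rw [div_mul_eq_mul_div, le_div_iff₀ hc0]
  exact (mul_le_mul_of_nonneg_right h2 hc0.le).trans h1

end Implications

theorem theorem1 {n : ℕ} (hn : 1 ≤ n) {Ω : Type*} [MeasurableSpace Ω] (P : Measure Ω)
    [IsProbabilityMeasure P] (X : ℝ≥0 → Ω → EuclideanSpace ℝ (Fin n))
    (hX : IsLevyProcess P X) (ψ : EuclideanSpace ℝ (Fin n) → ℂ) (hψ : IsCharExponent P X ψ) :
    List.TFAE [HartmanWintner ψ, HasSmoothDensities P X, HasSobolevDensities P X] ∧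
    (IsIsotropicProcess P X →
      ∀ g : ℝ → ℝ, MonotoneOn g (Set.Ici 0) → (∀ ξ, ψ ξ = ((g (‖ξ‖ ^ 2) : ℝ) : ℂ)) →
      List.TFAE [HartmanWintner ψ, HasSmoothDensities P X, HasSobolevDensities P X,
        HasCInftyDensities P X, HasBoundedDensities P X, HasIntegrableExp ψ]) := by
  have hm := hX.measurable
  have hab := HartmanWintner.hasSmoothDensities hm hψ
  have hbc := HasSmoothDensities.hasSobolevDensities (P := P) (X := X)
  have hca := HasSobolevDensities.hartmanWintner hψ
  refine ⟨?_, fun _ g hg hψg => ?_⟩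
  · tfae_have 1 → 2 := hab
    tfae_have 2 → 3 := hbc
    tfae_have 3 → 1 := hca
    tfae_finish
  · tfae_have 1 → 2 := hab
    tfae_have 2 → 3 := hbc
    tfae_have 3 → 1 := hca
    tfae_have 2 → 4 := HasSmoothDensities.hasCInftyDensities
    tfae_have 4 → 5 := HasCInftyDensities.hasBoundedDensities
    tfae_have 5 → 6 := HasBoundedDensities.hasIntegrableExp hm hψ fun ξ => by simp [hψg ξ]
    tfae_have 6 → 1 := HasIntegrableExp.hartmanWintner hn hg hψg
    tfae_finish
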